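/- Let $\mathbb H$ be the quaternions and $\mathbb S=\{I\in\mathbb H: I^2=-1\}$; for $I\in\mathbb S$ let $\mathbb C_I=\mathbb R+\mathbb R I$, and $\overline{\partial_I}=\frac12(\partial_x+I\partial_y)$, $\partial_I=\frac12(\partial_x-I\partial_y)$, acting on functions of $x+Iy\in\mathbb C_I$. For $n\ge 0$ let $\mathcal{SR}_n$ be the space of S-polyregular functions of level $n$, that is, of all real differentiable slice functions $f:\mathbb H\to\mathbb H$ (meaning $f(x+Iy)=\alpha(x,y)+I\beta(x,y)$ for all $x,y\in\mathbb R$, $I\in\mathbb S$, with $\alpha,\beta$ independent of $I$) such that for every $I\in\mathbb S$ the derivatives $\overline{\partial_I}^{k}(f|_{\mathbb C_I})$, $k\le n$, are real differentiable and $\overline{\partial_I}^{\,n+1}(f|_{\mathbb C_I})=0$ on $\mathbb C_I$. For $q=x+I_qy$ with $I_q\in\mathbb S$, $y\ge 0$, put $(\partial_s f)(q)=(\partial_{I_q}f|_{\mathbb C_{I_q}})(q)$ and $(\overline{\partial_s}f)(q)=(\overline{\partial_{I_q}}f|_{\mathbb C_{I_q}})(q)$ (for real $q$ a fixed imaginary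 unit, $I_q=\mathbf i$, is used; for differentiable slice functions the value does not depend on this choice). Put $$\Box_q=-\partial_s\overline{\partial_s}+\overline q\,\overline{\partial_s},\qquad \mathcal H_k=(\partial_s-\overline q)^k,\qquad H^Q_{j,k}(q,\overline q)=j!\,k!\sum_{i=0}^{\min(j,k)}\frac{(-1)^i}{i!}\,\frac{q^{j-i}\,\overline q^{\,k-i}}{(j-i)!\,(k-i)!}.$$ Fix $I\in\mathbb S$ and $n\ge 0$, and for every $m\ge 0$ let $\mathcal{SR}^2_m$ be the set of all $f\in\mathcal{SR}_m$ with $f|_{\mathbb C_I}\in L^2(\mathbb C_I;e^{-|q|^2}d\lambda_I)$, where $\lambda_I$ is Lebesgue measure on $\mathbb C_I\cong\mathbb R^2$. Then: (i) $\mathcal{SR}_n^2$ is spanned by the quaternionic Hermite polynomials $H^Q_{j,k}$, $j\ge 0$, $0\le k\le n$: they all belong to $\mathcal{SR}^2_n$, and the set of (classes of) restrictions to $\mathbb C_I$ of the functions in $\mathcal{SR}_n^2$ is exactly the closure in $L^2(\mathbb C_I;e^{-|q|^2}d\lambda_I)$ of the right $\mathbb H$-linear span of the restrictions of these polynomials.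 Moreover $$\mathcal{SR}_n^2=\sum_{k=0}^n\mathcal H_k(\mathcal{SR}_0^2),$$ that is, a function $f:\mathbb H\to\mathbb H$ is in $\mathcal{SR}^2_n$ if and only if $f=\sum_{k=0}^n\mathcal H_k(F_k)$ for some $F_0,\dots,F_n\in\mathcal{SR}^2_0$. (ii) A function $f:\mathbb H\to\mathbb H$ belongs to $\mathcal{SR}_n^2$ and satisfies $\Box_qf=nf$ on $\mathbb H$ if and only if $f=\mathcal H_n(F)$ for some $F\in\mathcal{SR}_0^2$. -/

import Mathlib

open MeasureTheory
open scoped Quaternion ENNReal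

noncomputable section

namespace SPolyregular

/-- The point `x + I y` of the slice `ℂ_I = ℝ + ℝ I`, for `z = x + i y`.
`f ∘ slicePt I` is the restriction of `f` to the slice `ℂ_I`, read in the coordinates `x, y`. -/
def slicePt (I : ℍ[ℝ]) (z : ℂ) : ℍ[ℝ] := (z.re : ℍ[ℝ]) + z.im • I

/-- The Cauchy--Riemann operator `∂̄_I = (∂_x + I ∂_y) / 2` on functions on the slice `ℂ_I`. -/
def dbarSlice (I : ℍ[ℝ]) (F : ℂ → ℍ[ℝ]) (z : ℂ) : ℍ[ℝ] :=
  (1 / 2 : ℝ) • (fderiv ℝ F z 1 + I * fderiv ℝ F z Complex.I)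

/-- The operator `∂_I = (∂_x - I ∂_y) / 2` on functions on the slice `ℂ_I`. -/
def dSlice (I : ℍ[ℝ]) (F : ℂ → ℍ[ℝ]) (z : ℂ) : ℍ[ℝ] :=
  (1 / 2 : ℝ) • (fderiv ℝ F z 1 - I * fderiv ℝ F z Complex.I)

/-- `f` is a (left) slice function: `f (x + I y) = α (x, y) + I β (x, y)` with `α`, `β` independent
of the imaginary unit `I`.  (The parity of `α` and `β` in `y` is automatic.) -/
def IsSliceFunction (f : ℍ[ℝ] → ℍ[ℝ]) : Prop :=
  ∃ α β : ℂ → ℍ[ℝ], ∀ I : ℍ[ℝ], I ^ 2 = -1 → ∀ z : ℂ, f (slicePt I z) = α z + I * β z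

/-- `F` is polyanalytic of level `n` (order `n + 1`) on the slice `ℂ_I`: the derivatives
`∂̄_I^k F`, `k ≤ n + 1`, exist and `∂̄_I^(n+1) F` vanishes identically. -/
def IsPolyanalytic (I : ℍ[ℝ]) (n : ℕ) (F : ℂ → ℍ[ℝ]) : Prop :=
  (∀ k ≤ n, Differentiable ℝ ((dbarSlice I)^[k] F)) ∧ ∀ z, (dbarSlice I)^[n + 1] F z = 0

/-- The space of S-polyregular functions of level `n` on the whole space of quaternions. -/
def SR (n : ℕ) : Set (ℍ[ℝ] → ℍ[ℝ]) :=
  {f | IsSliceFunction f ∧ Differentiable ℝ f ∧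
    ∀ I : ℍ[ℝ], I ^ 2 = -1 → IsPolyanalytic I n (f ∘ slicePt I)}

/-- The measure `e^{-|z|^2} dx dy`. -/
def gaussianMeasure : Measure ℂ :=
  volume.withDensity fun z => ENNReal.ofReal (Real.exp (-‖z‖ ^ 2))

/-- The S-polyregular functions of level `n` whose restriction to `ℂ_I` is in
`L²(ℂ_I; e^{-|q|²} dλ_I)`. For `n = 0` this is the slice Bargmann space. -/
def SR2 (I : ℍ[ℝ]) (n : ℕ) : Set (ℍ[ℝ] → ℍ[ℝ]) :=
  {f | f ∈ SR n ∧ MemLp (f ∘ slicePt I) 2 gaussianMeasure}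

/-- The imaginary unit `𝐢`. -/
def unitI : ℍ[ℝ] := ⟨0, 1, 0, 0⟩

open Classical in
/-- The imaginary unit `I_q` of `q = x + I_q y`, `y ≥ 0`; it is unique if `q` is not real.
For a real `q` every imaginary unit is admissible and `𝐢` is taken: for differentiable
slice functions the slice derivatives below do not depend on this choice. -/
def sliceUnit (q : ℍ[ℝ]) : ℍ[ℝ] :=
  if q.im = 0 then unitI else ‖q.im‖⁻¹ • q.im

/-- The coordinates `(x, y)`, `y ≥ 0`, of `q = x + I_q y` in its slice. -/
def sliceCoord (q : ℍ[ℝ]) : ℂ := ⟨q.re, ‖q.im‖⟩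

/-- The slice derivative `∂_s`: `(∂_s f)(q) = (∂_{I_q} f|_{ℂ_{I_q}})(q)`. -/
def sliceD (f : ℍ[ℝ] → ℍ[ℝ]) (q : ℍ[ℝ]) : ℍ[ℝ] :=
  dSlice (sliceUnit q) (f ∘ slicePt (sliceUnit q)) (sliceCoord q)

/-- The conjugate slice derivative: `(∂̄_s f)(q) = (∂̄_{I_q} f|_{ℂ_{I_q}})(q)`. -/
def sliceDbar (f : ℍ[ℝ] → ℍ[ℝ]) (q : ℍ[ℝ]) : ℍ[ℝ] :=
  dbarSlice (sliceUnit q) (f ∘ slicePt (sliceUnit q)) (sliceCoord q)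

/-- The operator `□_q = - ∂_s ∂̄_s + q̄ ∂̄_s`. -/
def sliceBox (f : ℍ[ℝ] → ℍ[ℝ]) (q : ℍ[ℝ]) : ℍ[ℝ] :=
  - sliceD (sliceDbar f) q + star q * sliceDbar f q

/-- The kernel of `□_q - n Id`. -/
def kerBoxSub (n : ℕ) : Set (ℍ[ℝ] → ℍ[ℝ]) :=
  {f | ∀ q, sliceBox f q - (n : ℝ) • f q = 0}

/-- The operator `𝓗_n = (∂_s - q̄)^n`. -/
def hermiteOp (n : ℕ) (F : ℍ[ℝ] → ℍ[ℝ]) : ℍ[ℝ] → ℍ[ℝ] :=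
  (fun (G : ℍ[ℝ] → ℍ[ℝ]) (q : ℍ[ℝ]) => sliceD G q - star q * G q)^[n] F

/-- The quaternionic Hermite polynomial
`H^Q_{m,n}(q, q̄) = m! n! ∑_{j ≤ min(m,n)} (-1)^j / j! · q^{m-j} q̄^{n-j} / ((m-j)! (n-j)!)`. -/
def hermiteQ (m n : ℕ) (q : ℍ[ℝ]) : ℍ[ℝ] :=
  ∑ j ∈ Finset.range (min m n + 1),
    ((m.factorial * n.factorial : ℝ) * ((-1) ^ j / j.factorial) /
        ((m - j).factorial * (n - j).factorial)) •
      (q ^ (m - j) * star q ^ (n - j))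

/-- The right quaternionic linear span, in `L²(ℂ_I; e^{-|q|²} dλ_I)`, of the restrictions of
`H^Q_{j,k}`, `j ≥ 0`, `0 ≤ k ≤ n`, that is the real span of all `H^Q_{j,k} c` with `c ∈ ℍ`. -/
def hermiteSpan (I : ℍ[ℝ]) (n : ℕ) : Submodule ℝ (Lp ℍ[ℝ] 2 gaussianMeasure) :=
  Submodule.span ℝ
    {g | ∃ (j k : ℕ) (c : ℍ[ℝ]), k ≤ n ∧
      (g : ℂ → ℍ[ℝ]) =ᵐ[gaussianMeasure] fun z => hermiteQ j k (slicePt I z) * c}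

end SPolyregular

end

open SPolyregular

/-!
On a slice `ℂ_I` everything reduces to the complex Hermite polynomials `H_{j,k}`. Since `slicePt I`
is an algebra homomorphism `ℂ → ℍ`, left multiplication by `I` makes `ℍ` a complex vector space, and
a function annihilated by `∂̄_I` is an entire power series `∑ z ^ j c_j` with coefficients on the
right. The recurrence `H_{j,k+1} = q̄ H_{j,k} - j H_{j-1,k}` says that `-(∂_s - q̄)` maps the Hermite
series `∑ⱼ H_{j,k} c_j` to `∑ⱼ H_{j,k+1} c_j` (`hermiteSeries_succ`), whereas `∂̄_s` maps it to
`k ∑ⱼ H_{j,k-1} c_j` (`hasFDerivAt_hermiteSeries_slice`). Hence `∑ⱼ H_{j,k} c_j` is an eigenfunction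
of `□_q` for the eigenvalue `k` (`sliceBox_hermiteSum`), and induction on the level shows that every
polyanalytic function of level `n` is a sum of Hermite series of indices `k ≤ n`
(`IsPolyanalytic.exists_hermiteSum`). A slice function is determined by one slice, so the same
expansion `f = ∑_{k ≤ n} ∑ⱼ H_{j,k} c_{k,j}` holds on `ℍ` for every S-polyregular function.

It remains to recognize the square integrable functions. The `H_{j,k}` are orthogonal in the Gaussian
space of the slice, with squared norms `π j! k!` (`integral_conj_hermiteC_mul`). The point is that
the coefficients `c_{k,j}` of a square integrable `f` are its coefficients in this orthogonal system
(`isHermiteCoeff_of_ae_eq_hermiteSum`). On a disc the expansion may be integrated term by term;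
there, rotation invariance leaves only the finitely many terms with the angular momentum of the
polynomial paired with `f`, so the radius can be sent to infinity. Bessel's inequality then gives
`∑ⱼ j! ‖c_{k,j}‖² < ∞`, which is exactly the condition for `∑ⱼ q ^ j c_{k,j}` to lie in the slice
Bargmann space. Conversely, under this condition the Hermite series converges both locally uniformly
and in the Gaussian space, to the same limit. The descriptions of `SR2 I n`, of the closed
span of the polynomials and of the kernel of `□_q - n` follow by comparing coefficients.
-/

namespace SPolyregular

/-! ### Slices of the quaternions -/

section Slice

variable {I : ℍ[ℝ]}

/-- For an imaginary unit `I`, the parametrization `slicePt I` of the slice `ℂ_I` is the algebra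
homomorphism `ℂ → ℍ` sending `i` to `I`. -/
lemma slicePt_eq_liftAux (hI : I ^ 2 = -1) (z : ℂ) :
    slicePt I z = Complex.liftAux I (by rw [← sq, hI]) z := by
  rw [Complex.liftAux_apply]; rfl

lemma slicePt_add (z w : ℂ) : slicePt I (z + w) = slicePt I z + slicePt I w := by
  simp only [slicePt, Complex.add_re, Complex.add_im, Quaternion.coe_add, add_smul]; abel

lemma slicePt_real_smul (r : ℝ) (z : ℂ) : slicePt I (r • z) = r • slicePt I z := by
  simp [slicePt, smul_add, mul_smul, ← Quaternion.coe_mul_eq_smul]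

lemma slicePt_mul (hI : I ^ 2 = -1) (z w : ℂ) :
    slicePt I (z * w) = slicePt I z * slicePt I w := by
  simp only [slicePt_eq_liftAux hI, map_mul]

lemma slicePt_pow (hI : I ^ 2 = -1) (z : ℂ) (m : ℕ) :
    slicePt I (z ^ m) = slicePt I z ^ m := by
  simp only [slicePt_eq_liftAux hI, map_pow]

lemma slicePt_sub (z w : ℂ) : slicePt I (z - w) = slicePt I z - slicePt I w := by
  simp only [slicePt, Complex.sub_re, Complex.sub_im, Quaternion.coe_sub, sub_smul]; abel

lemma slicePt_neg (z : ℂ) : slicePt I (-z) = -slicePt I z := by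
  simp only [slicePt, Complex.neg_re, Complex.neg_im, Quaternion.coe_neg, neg_smul]; abel

@[simp] lemma slicePt_one : slicePt I 1 = 1 := by simp [slicePt]

@[simp] lemma slicePt_I : slicePt I Complex.I = I := by simp [slicePt]

lemma re_eq_zero_of_sq (hI : I ^ 2 = -1) : I.re = 0 := by
  have h : I * I = -1 := by rw [← sq, hI]
  have h0 := congrArg QuaternionAlgebra.re h
  have h1 := congrArg QuaternionAlgebra.imI h
  have h2 := congrArg QuaternionAlgebra.imJ h
  have h3 := congrArg QuaternionAlgebra.imK h
  simp at h0 h1 h2 h3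
  by_contra hne
  have e1 : I.imI = 0 := by
    have : I.re * I.imI = 0 := by linarith
    simpa [hne] using this
  have e2 : I.imJ = 0 := by
    have : I.re * I.imJ = 0 := by linarith
    simpa [hne] using this
  have e3 : I.imK = 0 := by
    have : I.re * I.imK = 0 := by linarith
    simpa [hne] using this
  rw [e1, e2, e3] at h0
  nlinarith [sq_nonneg I.re]

lemma star_eq_neg_of_sq (hI : I ^ 2 = -1) : star I = -I := by
  have := re_eq_zero_of_sq hI
  ext <;> simp [this]

lemma neg_sq_eq (hI : I ^ 2 = -1) : (-I) ^ 2 = -1 := by rw [neg_sq, hI]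

open ComplexConjugate in
lemma slicePt_conj (hI : I ^ 2 = -1) (z : ℂ) :
    slicePt I (conj z) = star (slicePt I z) := by
  simp [slicePt, star_eq_neg_of_sq hI]

open ComplexConjugate in
lemma slicePt_neg_unit (z : ℂ) : slicePt (-I) z = slicePt I (conj z) := by
  simp [slicePt]

lemma norm_slicePt (hI : I ^ 2 = -1) (z : ℂ) : ‖slicePt I z‖ = ‖z‖ := by
  have h : slicePt I z * star (slicePt I z) = ((‖z‖ ^ 2 : ℝ) : ℍ[ℝ]) := by
    rw [← slicePt_conj hI, ← slicePt_mul hI, Complex.mul_conj, Complex.normSq_eq_norm_sq]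
    simp only [slicePt, Complex.ofReal_re, Complex.ofReal_im, zero_smul, add_zero]
  rw [Quaternion.self_mul_star] at h
  have h2 := Quaternion.coe_injective h
  rw [Quaternion.normSq_eq_norm_mul_self, ← sq] at h2
  exact (pow_left_inj₀ (norm_nonneg _) (norm_nonneg _) two_ne_zero).1 h2

/-- The parametrization of a slice as a continuous real linear map. -/
noncomputable def slicePtL (I : ℍ[ℝ]) : ℂ →L[ℝ] ℍ[ℝ] :=
  LinearMap.toContinuousLinearMap
    { toFun := slicePt I
      map_add' := slicePt_add
      map_smul' := slicePt_real_smul }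

@[simp] lemma slicePtL_apply (z : ℂ) : slicePtL I z = slicePt I z := rfl

lemma continuous_slicePt : Continuous (slicePt I) := (slicePtL I).continuous

lemma unitI_sq : unitI ^ 2 = -1 := by
  rw [sq, unitI]
  erw [QuaternionAlgebra.mk_mul_mk]
  ext <;> simp

lemma sliceUnit_sq (q : ℍ[ℝ]) : sliceUnit q ^ 2 = -1 := by
  unfold sliceUnit
  split_ifs with h
  · exact unitI_sq
  · have hn : ‖q.im‖ ≠ 0 := norm_ne_zero_iff.2 h
    rw [smul_pow, Quaternion.im_sq, Quaternion.normSq_eq_norm_mul_self, smul_neg,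
      ← Quaternion.coe_mul_eq_smul, ← Quaternion.coe_mul, ← sq, ← mul_pow, inv_mul_cancel₀ hn]
    simp

lemma slicePt_sliceUnit (q : ℍ[ℝ]) : slicePt (sliceUnit q) (sliceCoord q) = q := by
  conv_rhs => rw [← Quaternion.re_add_im q]
  unfold slicePt sliceUnit sliceCoord
  split_ifs with h
  · simp [h]
  · have hn : ‖q.im‖ ≠ 0 := norm_ne_zero_iff.2 h
    simp only [smul_smul, mul_inv_cancel₀ hn, one_smul]

/-- A slice function is determined by its restriction to a single slice. -/
lemma IsSliceFunction.ext_slice {f g : ℍ[ℝ] → ℍ[ℝ]} (hf : IsSliceFunction f)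
    (hg : IsSliceFunction g) (hI : I ^ 2 = -1) (h : ∀ z, f (slicePt I z) = g (slicePt I z)) :
    f = g := by
  obtain ⟨α, β, hf⟩ := hf
  obtain ⟨α', β', hg⟩ := hg
  have key : ∀ z, α z = α' z ∧ β z = β' z := by
    intro z
    have h1 := h z
    rw [hf I hI, hg I hI] at h1
    -- the value at the conjugate point gives the equation with the sign of `I` reversed
    have h2 := h (starRingEnd ℂ z)
    rw [← slicePt_neg_unit, hf _ (neg_sq_eq hI), hg _ (neg_sq_eq hI)] at h2
    have ha : (2 : ℝ) • α z = (2 : ℝ) • α' z := by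
      simp only [two_smul]
      calc α z + α z = (α z + I * β z) + (α z + -I * β z) := by rw [neg_mul]; abel
        _ = (α' z + I * β' z) + (α' z + -I * β' z) := by rw [h1, h2]
        _ = α' z + α' z := by rw [neg_mul]; abel
    have ha' : α z = α' z := smul_right_injective _ (two_ne_zero) ha
    refine ⟨ha', ?_⟩
    rw [ha', add_right_inj] at h1
    have := congrArg (I * ·) h1
    simpa [← mul_assoc, ← sq, hI] using this
  funext q
  rw [← slicePt_sliceUnit q, hf _ (sliceUnit_sq q), hg _ (sliceUnit_sq q), (key _).1, (key _).2]

end Slice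

/-! ### First-order operators on a slice -/

section SliceDerivative

open ComplexConjugate

variable {I : ℍ[ℝ]}

/-- The real linear map `w ↦ w A + w̄ B` on the slice `ℂ_I`. It is the differential of a function
whose derivatives `∂_I` and `∂̄_I` are `A` and `B`. -/
noncomputable def wirtinger (I A B : ℍ[ℝ]) : ℂ →L[ℝ] ℍ[ℝ] :=
  (ContinuousLinearMap.mul ℝ ℍ[ℝ]).flip A ∘L slicePtL I +
    (ContinuousLinearMap.mul ℝ ℍ[ℝ]).flip B ∘L slicePtL I ∘L Complex.conjCLE.toContinuousLinearMap

lemma wirtinger_apply (A B : ℍ[ℝ]) (w : ℂ) :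
    wirtinger I A B w = slicePt I w * A + slicePt I (conj w) * B := rfl

lemma dSlice_eq_of_hasFDerivAt (hI : I ^ 2 = -1) {F : ℂ → ℍ[ℝ]} {z : ℂ} {A B : ℍ[ℝ]}
    (h : HasFDerivAt F (wirtinger I A B) z) : dSlice I F z = A := by
  have hII : I * I = -1 := by rw [← sq, hI]
  rw [dSlice, h.fderiv, wirtinger_apply, wirtinger_apply]
  simp only [map_one, Complex.conj_I, slicePt_one, slicePt_I, one_mul, mul_add, ← mul_assoc,
    slicePt_neg, mul_neg, neg_mul, hII, neg_neg]
  rw [show A + B - (-A + B) = (2 : ℝ) • A by rw [two_smul]; abel, smul_smul]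
  norm_num

lemma dbarSlice_eq_of_hasFDerivAt (hI : I ^ 2 = -1) {F : ℂ → ℍ[ℝ]} {z : ℂ} {A B : ℍ[ℝ]}
    (h : HasFDerivAt F (wirtinger I A B) z) : dbarSlice I F z = B := by
  have hII : I * I = -1 := by rw [← sq, hI]
  rw [dbarSlice, h.fderiv, wirtinger_apply, wirtinger_apply]
  simp only [map_one, Complex.conj_I, slicePt_one, slicePt_I, one_mul, mul_add, ← mul_assoc,
    slicePt_neg, mul_neg, neg_mul, hII, neg_neg]
  rw [show A + B + (-A + B) = (2 : ℝ) • B by rw [two_smul]; abel, smul_smul]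
  norm_num

lemma hasFDerivAt_wirtinger_sub {F G : ℂ → ℍ[ℝ]} {z : ℂ} {A B A' B' : ℍ[ℝ]}
    (hF : HasFDerivAt F (wirtinger I A B) z) (hG : HasFDerivAt G (wirtinger I A' B') z) :
    HasFDerivAt (fun z => F z - G z) (wirtinger I (A - A') (B - B')) z := by
  refine (hF.sub hG).congr_fderiv ?_
  ext w <;> simp [wirtinger_apply] <;> ring

lemma hasFDerivAt_wirtinger_sum {ι : Type*} (s : Finset ι) {F : ι → ℂ → ℍ[ℝ]} {z : ℂ}
    {A B : ι → ℍ[ℝ]} (hF : ∀ i ∈ s, HasFDerivAt (F i) (wirtinger I (A i) (B i)) z) :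
    HasFDerivAt (fun z => ∑ i ∈ s, F i z) (wirtinger I (∑ i ∈ s, A i) (∑ i ∈ s, B i)) z := by
  refine (HasFDerivAt.fun_sum hF).congr_fderiv ?_
  ext1 w
  simp [wirtinger_apply, Finset.mul_sum, Finset.sum_add_distrib]

/-- Leibniz rule for multiplication by the conjugate variable. -/
lemma hasFDerivAt_wirtinger_conj_mul (hI : I ^ 2 = -1) {F : ℂ → ℍ[ℝ]} {z : ℂ} {A B : ℍ[ℝ]}
    (hF : HasFDerivAt F (wirtinger I A B) z) :
    HasFDerivAt (fun z => star (slicePt I z) * F z)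
      (wirtinger I (star (slicePt I z) * A) (F z + star (slicePt I z) * B)) z := by
  have h1 : HasFDerivAt (fun z : ℂ => star (slicePt I z))
      (slicePtL I ∘L Complex.conjCLE.toContinuousLinearMap) z := by
    have := (slicePtL I ∘L Complex.conjCLE.toContinuousLinearMap).hasFDerivAt (x := z)
    refine this.congr_of_eventuallyEq (Filter.Eventually.of_forall fun w => ?_)
    simp [← slicePt_conj hI]
  refine (h1.mul' hF).congr_fderiv ?_
  ext1 w
  simp only [wirtinger_apply, add_apply, smul_apply,
    ContinuousLinearMap.comp_apply, slicePtL_apply, smul_eq_mul, mul_add, ← mul_assoc,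
    MulOpposite.smul_eq_mul_unop, MulOpposite.unop_op,
    ← slicePt_conj hI, ← slicePt_mul hI, mul_comm (conj z)]
  simp
  abel

end SliceDerivative

/-! ### Hermite polynomials and Hermite series -/

section HermiteSeries

lemma hermiteQ_eq_sum_choose (j k : ℕ) (q : ℍ[ℝ]) :
    hermiteQ j k q = ∑ i ∈ Finset.range (k + 1),
      ((-1 : ℝ) ^ i * k.choose i * j.descFactorial i) • (q ^ (j - i) * star q ^ (k - i)) := by
  have hsub : Finset.range (min j k + 1) ⊆ Finset.range (k + 1) :=
    Finset.range_subset_range.2 (by omega)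
  rw [hermiteQ]
  refine Finset.sum_subset_zero_on_sdiff hsub (fun i hi => ?_) (fun i hi => ?_)
  · -- the terms with `j < i` vanish
    simp only [Finset.mem_sdiff, Finset.mem_range] at hi
    rw [Nat.descFactorial_eq_zero_iff_lt.2 (by omega)]
    simp
  · have hi' := Finset.mem_range.1 hi
    have hj : i ≤ j := by omega
    have hk : i ≤ k := by omega
    congr 1
    rw [Nat.cast_choose ℝ hk]
    have h := Nat.factorial_mul_descFactorial hj
    rw [← h]
    have : ((j - i).factorial : ℝ) ≠ 0 := by positivity
    have : ((k - i).factorial : ℝ) ≠ 0 := by positivity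
    have : (i.factorial : ℝ) ≠ 0 := by positivity
    push_cast
    field_simp

lemma commute_star_self (q : ℍ[ℝ]) : Commute (star q) q := by
  rw [commute_iff_eq, Quaternion.star_mul_self, Quaternion.self_mul_star]

/-- The recurrence `H_{j,k+1} = q̄ H_{j,k} - j H_{j-1,k}`. For `j = 0` the last term is absent, so
the truncated subtraction is harmless. -/
lemma hermiteQ_succ_right (j k : ℕ) (q : ℍ[ℝ]) :
    hermiteQ j (k + 1) q = star q * hermiteQ j k q - (j : ℝ) • hermiteQ (j - 1) k q := by
  have hA : star q * hermiteQ j k q = ∑ i ∈ Finset.range (k + 2),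
      ((-1 : ℝ) ^ i * k.choose i * j.descFactorial i) • (q ^ (j - i) * star q ^ (k + 1 - i)) := by
    rw [Finset.sum_range_succ, Nat.choose_succ_self, hermiteQ_eq_sum_choose, Finset.mul_sum]
    simp only [Nat.cast_zero, mul_zero, zero_mul, zero_smul, add_zero]
    refine Finset.sum_congr rfl fun i hi => ?_
    have hi' := Finset.mem_range.1 hi
    rw [mul_smul_comm, ← mul_assoc, ((commute_star_self q).pow_right _).eq, mul_assoc (q ^ (j - i)),
      ← pow_succ', show k - i + 1 = k + 1 - i by omega]
  have hB : (j : ℝ) • hermiteQ (j - 1) k q = -∑ i ∈ Finset.range (k + 1),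
      ((-1 : ℝ) ^ (i + 1) * k.choose i * j.descFactorial (i + 1)) •
        (q ^ (j - (i + 1)) * star q ^ (k + 1 - (i + 1))) := by
    rw [hermiteQ_eq_sum_choose, Finset.smul_sum, ← Finset.sum_neg_distrib]
    refine Finset.sum_congr rfl fun i _ => ?_
    rw [smul_smul, ← neg_smul, Nat.add_sub_add_right, show j - 1 - i = j - (i + 1) by omega]
    congr 1
    rcases j with _ | j
    · simp
    · rw [Nat.succ_descFactorial_succ]
      push_cast
      ring
  rw [hA, hB, hermiteQ_eq_sum_choose, Finset.sum_range_succ', Finset.sum_range_succ' _ (k + 1),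
    sub_neg_eq_add, add_right_comm, ← Finset.sum_add_distrib]
  congr 1
  · refine Finset.sum_congr rfl fun i _ => ?_
    rw [← add_smul, Nat.choose_succ_succ]
    push_cast
    congr 1
    ring
  · simp

lemma hermiteQ_zero_right (j : ℕ) (q : ℍ[ℝ]) : hermiteQ j 0 q = q ^ j := by
  have : (j.factorial : ℝ) ≠ 0 := by positivity
  simp [hermiteQ, this]

/-- A crude bound, geometric in `j` for fixed `k`. -/
lemma norm_hermiteQ_le (j k : ℕ) {R : ℝ} (hR : 1 ≤ R) {q : ℍ[ℝ]} (hq : ‖q‖ ≤ R) :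
    ‖hermiteQ j k q‖ ≤ (R + j) ^ k * R ^ j := by
  have hR0 : 0 ≤ R := by linarith
  induction k generalizing j with
  | zero =>
    rw [hermiteQ_zero_right, pow_zero, one_mul, norm_pow]
    gcongr
  | succ k ih =>
    rw [hermiteQ_succ_right]
    have h1 : ‖star q * hermiteQ j k q‖ ≤ R * ((R + j) ^ k * R ^ j) := by
      rw [norm_mul, norm_star]
      exact mul_le_mul hq (ih j) (norm_nonneg _) hR0
    have h2 : ‖(j : ℝ) • hermiteQ (j - 1) k q‖ ≤ j * ((R + j) ^ k * R ^ j) := by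
      rw [norm_smul, Real.norm_natCast]
      refine mul_le_mul_of_nonneg_left ((ih (j - 1)).trans ?_) (Nat.cast_nonneg j)
      have : ((j - 1 : ℕ) : ℝ) ≤ j := by exact_mod_cast Nat.sub_le j 1
      have h3 : R ^ (j - 1) ≤ R ^ j := pow_le_pow_right₀ hR (Nat.sub_le j 1)
      gcongr
    calc _ ≤ _ := norm_sub_le _ _
      _ ≤ R * ((R + j) ^ k * R ^ j) + j * ((R + j) ^ k * R ^ j) := add_le_add h1 h2
      _ = _ := by ring

/-- `c` is the sequence of coefficients of an entire power series `∑ q ^ j c_j`. -/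
def EntireCoeff (c : ℕ → ℍ[ℝ]) : Prop := ∀ r : ℝ, 0 ≤ r → Summable fun j => r ^ j * ‖c j‖

lemma _root_.HasSum.congr_terms {f g : ℕ → ℍ[ℝ]} {a : ℍ[ℝ]} (hf : HasSum f a)
    (h : ∀ j, g j = f j) : HasSum g a := by
  rwa [funext h]

/-- The coefficients of the derivative of the power series `∑ q ^ j c_j`. -/
noncomputable def dcoeff (c : ℕ → ℍ[ℝ]) (j : ℕ) : ℍ[ℝ] := ((j : ℝ) + 1) • c (j + 1)

lemma natCast_add_one_le_two_pow (j : ℕ) : (j : ℝ) + 1 ≤ 2 ^ j := by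
  exact_mod_cast Nat.lt_two_pow_self (n := j)

lemma EntireCoeff.dcoeff {c : ℕ → ℍ[ℝ]} (hc : EntireCoeff c) : EntireCoeff (dcoeff c) := by
  intro r hr
  have h := (summable_nat_add_iff 1).2 (hc (2 * r + 1) (by linarith))
  refine Summable.of_nonneg_of_le (fun j => by positivity) (fun j => ?_) h
  rw [SPolyregular.dcoeff, norm_smul, Real.norm_of_nonneg (by positivity), ← mul_assoc]
  gcongr
  calc r ^ j * ((j : ℝ) + 1) ≤ r ^ j * 2 ^ j := by
        gcongr; exact natCast_add_one_le_two_pow j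
    _ = (2 * r) ^ j := by rw [mul_pow]; ring
    _ ≤ (2 * r + 1) ^ j := by gcongr; linarith
    _ ≤ (2 * r + 1) ^ (j + 1) := pow_le_pow_right₀ (by linarith) (Nat.le_succ j)

lemma EntireCoeff.smul {c : ℕ → ℍ[ℝ]} (hc : EntireCoeff c) (a : ℝ) :
    EntireCoeff fun j => a • c j := by
  intro r hr
  refine ((hc r hr).mul_left |a|).congr fun j => ?_
  rw [norm_smul, Real.norm_eq_abs]; ring

lemma entireCoeff_single (j : ℕ) (a : ℍ[ℝ]) : EntireCoeff (Pi.single j a) := by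
  intro r _
  refine summable_of_ne_finset_zero (s := {j}) fun b hb => ?_
  rw [Pi.single_eq_of_ne (by simpa using hb), norm_zero, mul_zero]

/-- A bound for the terms of a Hermite series on the ball of radius `R`. -/
noncomputable def hermiteBound (k : ℕ) (c : ℕ → ℍ[ℝ]) (R : ℝ) (j : ℕ) : ℝ :=
  (R + 1) ^ k * ((2 ^ k * R) ^ j * ‖c j‖)

lemma summable_hermiteBound (k : ℕ) {c : ℕ → ℍ[ℝ]} (hc : EntireCoeff c) {R : ℝ} (hR : 1 ≤ R) :
    Summable (hermiteBound k c R) :=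
  (hc (2 ^ k * R) (by positivity)).mul_left _

lemma norm_hermiteQ_mul_le (j k : ℕ) (c : ℕ → ℍ[ℝ]) {R : ℝ} (hR : 1 ≤ R) {q : ℍ[ℝ]}
    (hq : ‖q‖ ≤ R) : ‖hermiteQ j k q * c j‖ ≤ hermiteBound k c R j := by
  rw [norm_mul, hermiteBound, ← mul_assoc]
  refine mul_le_mul_of_nonneg_right ((norm_hermiteQ_le j k hR hq).trans ?_) (norm_nonneg _)
  calc (R + j) ^ k * R ^ j ≤ ((R + 1) * 2 ^ j) ^ k * R ^ j := by
        gcongr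
        nlinarith [natCast_add_one_le_two_pow j, Nat.cast_nonneg (α := ℝ) j]
    _ = (R + 1) ^ k * (2 ^ k * R) ^ j := by
        rw [mul_pow, mul_pow, ← pow_mul, ← pow_mul, mul_comm j k, mul_assoc]

lemma summable_hermiteQ_mul (k : ℕ) {c : ℕ → ℍ[ℝ]} (hc : EntireCoeff c) (q : ℍ[ℝ]) :
    Summable fun j => hermiteQ j k q * c j :=
  Summable.of_norm_bounded (summable_hermiteBound k hc (R := 1 + ‖q‖) (by simp))
    fun j => norm_hermiteQ_mul_le j k c (by simp) (by simp)

/-- The Hermite series `∑ⱼ H_{j,k} c_j`, of index `k`. It converges everywhere if `c` satisfies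
`EntireCoeff`. -/
noncomputable def hermiteSeries (k : ℕ) (c : ℕ → ℍ[ℝ]) (q : ℍ[ℝ]) : ℍ[ℝ] :=
  ∑' j, hermiteQ j k q * c j

lemma hasSum_hermiteSeries (k : ℕ) {c : ℕ → ℍ[ℝ]} (hc : EntireCoeff c) (q : ℍ[ℝ]) :
    HasSum (fun j => hermiteQ j k q * c j) (hermiteSeries k c q) :=
  (summable_hermiteQ_mul k hc q).hasSum

/-- The recurrence of the Hermite polynomials, summed: it expresses that
`-(∂_s - q̄)` raises the second index. -/
lemma hermiteSeries_succ (k : ℕ) {c : ℕ → ℍ[ℝ]} (hc : EntireCoeff c) (q : ℍ[ℝ]) :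
    hermiteSeries (k + 1) c q = star q * hermiteSeries k c q - hermiteSeries k (dcoeff c) q := by
  have h1 := (hasSum_hermiteSeries k hc q).mul_left (star q)
  have h2 := hasSum_hermiteSeries k hc.dcoeff q
  have h3 : HasSum (fun j : ℕ => (j : ℝ) • (hermiteQ (j - 1) k q * c j))
      (hermiteSeries k (dcoeff c) q) := by
    rw [← hasSum_nat_add_iff' 1]
    simp only [Finset.range_one, Finset.sum_singleton, Nat.cast_zero, zero_smul, sub_zero]
    refine h2.congr_terms fun j => ?_
    simp [dcoeff]
  refine HasSum.unique (hasSum_hermiteSeries (k + 1) hc q) ?_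
  refine (h1.sub h3).congr_terms fun j => ?_
  rw [hermiteQ_succ_right, sub_mul, mul_assoc, smul_mul_assoc]

lemma hermiteSeries_smul (k : ℕ) (c : ℕ → ℍ[ℝ]) (a : ℝ) (q : ℍ[ℝ]) :
    hermiteSeries k (fun j => a • c j) q = a • hermiteSeries k c q := by
  simp only [hermiteSeries, mul_smul_comm]
  exact tsum_const_smul'' a

lemma hermiteSeries_single (k j : ℕ) (a q : ℍ[ℝ]) :
    hermiteSeries k (Pi.single j a) q = hermiteQ j k q * a := by
  rw [hermiteSeries, tsum_eq_single j]
  · simp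
  · intro b hb
    simp [Pi.single_eq_of_ne hb]

end HermiteSeries

/-! ### Slice derivatives of Hermite series -/

section Derivatives

variable {I : ℍ[ℝ]}

/-- The differential of `q ↦ q ^ j c` at `q`. -/
noncomputable def powMulDeriv (j : ℕ) (c q : ℍ[ℝ]) : ℍ[ℝ] →L[ℝ] ℍ[ℝ] :=
  ∑ i ∈ Finset.range j, (ContinuousLinearMap.mul ℝ ℍ[ℝ] (q ^ (j.pred - i))) ∘L
    (ContinuousLinearMap.mul ℝ ℍ[ℝ]).flip (q ^ i * c)

lemma powMulDeriv_apply (j : ℕ) (c q v : ℍ[ℝ]) :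
    powMulDeriv j c q v = ∑ i ∈ Finset.range j, q ^ (j.pred - i) * (v * (q ^ i * c)) := by
  simp [powMulDeriv]

lemma hasFDerivAt_pow_mul (j : ℕ) (c q : ℍ[ℝ]) :
    HasFDerivAt (fun q => q ^ j * c) (powMulDeriv j c q) q := by
  have h := ((hasFDerivAt_id (𝕜 := ℝ) q).pow' j).mul_const' c
  refine h.congr_fderiv ?_
  ext1 v
  rw [powMulDeriv_apply]
  simp [Finset.sum_mul, mul_assoc]

lemma norm_powMulDeriv_le (j : ℕ) (c : ℍ[ℝ]) {q : ℍ[ℝ]} {R : ℝ} (hR : 1 ≤ R) (hq : ‖q‖ ≤ R) :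
    ‖powMulDeriv j c q‖ ≤ (2 * R) ^ j * ‖c‖ := by
  have hR0 : 0 ≤ R := by linarith
  refine ContinuousLinearMap.opNorm_le_bound _ (by positivity) fun v => ?_
  rw [powMulDeriv_apply]
  calc _ ≤ ∑ i ∈ Finset.range j, R ^ j * ‖c‖ * ‖v‖ := by
        refine norm_sum_le_of_le _ fun i hi => ?_
        have hi' := Finset.mem_range.1 hi
        have e : (j.pred - i) + i ≤ j := by simp only [Nat.pred_eq_sub_one]; omega
        rw [norm_mul, norm_mul, norm_mul, norm_pow, norm_pow]
        calc _ = ‖q‖ ^ ((j.pred - i) + i) * ‖c‖ * ‖v‖ := by rw [pow_add]; ring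
          _ ≤ R ^ ((j.pred - i) + i) * ‖c‖ * ‖v‖ := by gcongr
          _ ≤ _ := by gcongr
    _ = j * (R ^ j * ‖c‖ * ‖v‖) := by simp
    _ ≤ 2 ^ j * (R ^ j * ‖c‖ * ‖v‖) := by
        gcongr
        linarith [natCast_add_one_le_two_pow j]
    _ = _ := by rw [mul_pow]; ring

lemma hasFDerivAt_hermiteSeries_zero {c : ℕ → ℍ[ℝ]} (hc : EntireCoeff c) (q : ℍ[ℝ]) :
    HasFDerivAt (hermiteSeries 0 c) (∑' j, powMulDeriv j (c j) q) q := by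
  set R := ‖q‖ + 1
  have hR : 1 ≤ R := by simp [R]
  have h : ∀ q, hermiteSeries 0 c q = ∑' j, q ^ j * c j := fun q => by
    simp only [hermiteSeries, hermiteQ_zero_right]
  rw [funext h]
  refine hasFDerivAt_tsum_of_isPreconnected (u := fun j => (2 * R) ^ j * ‖c j‖)
    (s := Metric.ball 0 R) (x₀ := q) (hc _ (by positivity)) Metric.isOpen_ball
    (convex_ball _ _).isPreconnected (fun j x _ => hasFDerivAt_pow_mul j (c j) x)
    (fun j x hx => norm_powMulDeriv_le j (c j) hR (mem_ball_zero_iff.1 hx).le) (by simp [R])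
    ?_ (by simp [R])
  simpa only [hermiteQ_zero_right] using summable_hermiteQ_mul 0 hc q

lemma hasSum_tsum_apply {E F : Type*} [NormedAddCommGroup E] [NormedSpace ℝ E]
    [NormedAddCommGroup F] [NormedSpace ℝ F] [CompleteSpace F] {f : ℕ → E →L[ℝ] F} {u : ℕ → ℝ}
    (hu : Summable u) (h : ∀ i, ‖f i‖ ≤ u i) (v : E) :
    HasSum (fun i => f i v) ((∑' i, f i) v) :=
  (Summable.of_norm_bounded hu h).hasSum.mapL (ContinuousLinearMap.apply ℝ F v)

lemma hasSum_powMulDeriv_apply {c : ℕ → ℍ[ℝ]} (hc : EntireCoeff c) (q v : ℍ[ℝ]) :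
    HasSum (fun j => powMulDeriv j (c j) q v) ((∑' j, powMulDeriv j (c j) q) v) := by
  have h1 : 1 ≤ ‖q‖ + 1 := by simp
  have h2 : ‖q‖ ≤ ‖q‖ + 1 := by simp
  exact hasSum_tsum_apply (hc (2 * (‖q‖ + 1)) (by positivity))
    (fun j => norm_powMulDeriv_le j (c j) h1 h2) v

lemma differentiable_hermiteSeries (k : ℕ) {c : ℕ → ℍ[ℝ]} (hc : EntireCoeff c) :
    Differentiable ℝ (hermiteSeries k c) := by
  induction k generalizing c with
  | zero => exact fun q => (hasFDerivAt_hermiteSeries_zero hc q).differentiableAt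
  | succ k ih =>
    rw [funext (hermiteSeries_succ k hc)]
    have : Differentiable ℝ (star : ℍ[ℝ] → ℍ[ℝ]) :=
      (LinearMap.toContinuousLinearMap
        { toFun := (star : ℍ[ℝ] → ℍ[ℝ])
          map_add' := star_add
          map_smul' := fun r q => by simp }).differentiable
    exact (this.mul (ih hc)).sub (ih hc.dcoeff)

/-- On each slice, `∂_I` of a Hermite series differentiates the coefficients and `∂̄_I` lowers the
second index. For `k = 0` the coefficient `k` of the last term vanishes. -/
lemma hasFDerivAt_hermiteSeries_slice (hI : I ^ 2 = -1) (k : ℕ) {c : ℕ → ℍ[ℝ]}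
    (hc : EntireCoeff c) (z : ℂ) :
    HasFDerivAt (hermiteSeries k c ∘ slicePt I)
      (wirtinger I (hermiteSeries k (dcoeff c) (slicePt I z))
        ((k : ℝ) • hermiteSeries (k - 1) c (slicePt I z))) z := by
  induction k generalizing c with
  | zero =>
    have h := (hasFDerivAt_hermiteSeries_zero hc (slicePt I z)).comp z (slicePtL I).hasFDerivAt
    refine h.congr_fderiv ?_
    ext1 w
    have h1 := hasSum_powMulDeriv_apply hc (slicePt I z) (slicePt I w)
    have h2 := (hasSum_hermiteSeries 0 hc.dcoeff (slicePt I z)).mul_left (slicePt I w)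
    rw [wirtinger_apply, Nat.cast_zero, zero_smul, mul_zero, add_zero]
    refine h1.unique ?_
    rw [← hasSum_nat_add_iff' 1]
    simp only [Finset.range_one, Finset.sum_singleton, powMulDeriv_apply, Finset.range_zero,
      Finset.sum_empty, sub_zero]
    refine h2.congr_terms fun j => ?_
    -- points of the same slice commute, so all the terms of the sum agree
    have h3 : ∀ i ∈ Finset.range (j + 1), slicePt I z ^ ((j + 1).pred - i) *
        (slicePt I w * (slicePt I z ^ i * c (j + 1))) =
          slicePt I w * (slicePt I z ^ j * c (j + 1)) := by
      intro i hi
      have hi' : j - i + i = j := by have := Finset.mem_range.1 hi; omega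
      rw [Nat.pred_succ, ← mul_assoc, ← mul_assoc, ← mul_assoc]
      simp only [← slicePt_pow hI, ← slicePt_mul hI]
      rw [mul_comm (z ^ (j - i)) w, mul_assoc w, ← pow_add, hi']
    rw [Finset.sum_congr rfl h3, hermiteQ_zero_right, dcoeff]
    simp [← Nat.cast_smul_eq_nsmul ℝ]
  | succ k ih =>
    have h := hasFDerivAt_wirtinger_sub (hasFDerivAt_wirtinger_conj_mul hI (ih hc)) (ih hc.dcoeff)
    have e : (hermiteSeries (k + 1) c ∘ slicePt I) = fun z =>
        star (slicePt I z) * (hermiteSeries k c ∘ slicePt I) z -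
          (hermiteSeries k (dcoeff c) ∘ slicePt I) z :=
      funext fun z => hermiteSeries_succ k hc _
    rw [e]
    convert h using 2
    · rw [hermiteSeries_succ k hc.dcoeff]
    · rcases k with _ | k
      · simp
      · simp only [Nat.add_sub_cancel, hermiteSeries_succ k hc, Function.comp_apply]
        push_cast
        simp only [add_smul, one_smul, smul_sub, mul_add, mul_smul_comm]
        abel

lemma dSlice_hermiteSeries (hI : I ^ 2 = -1) (k : ℕ) {c : ℕ → ℍ[ℝ]} (hc : EntireCoeff c) (z : ℂ) :
    dSlice I (hermiteSeries k c ∘ slicePt I) z = hermiteSeries k (dcoeff c) (slicePt I z) :=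
  dSlice_eq_of_hasFDerivAt hI (hasFDerivAt_hermiteSeries_slice hI k hc z)

lemma sliceD_hermiteSeries (k : ℕ) {c : ℕ → ℍ[ℝ]} (hc : EntireCoeff c) (q : ℍ[ℝ]) :
    sliceD (hermiteSeries k c) q = hermiteSeries k (dcoeff c) q := by
  rw [sliceD, dSlice_hermiteSeries (sliceUnit_sq q) k hc, slicePt_sliceUnit]

/-- The operator `(∂_s - q̄) ^ k` maps `∑ q ^ j c_j` to the Hermite series of index `k`, up to
sign. -/
lemma hermiteOp_hermiteSeries_zero (k : ℕ) {c : ℕ → ℍ[ℝ]} (hc : EntireCoeff c) :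
    hermiteOp k (hermiteSeries 0 c) = hermiteSeries k fun j => (-1 : ℝ) ^ k • c j := by
  induction k with
  | zero => simp [hermiteOp]
  | succ k ih =>
    have h : hermiteOp (k + 1) (hermiteSeries 0 c) = fun q =>
        sliceD (hermiteOp k (hermiteSeries 0 c)) q
          - star q * hermiteOp k (hermiteSeries 0 c) q := by
      simp only [hermiteOp, Function.iterate_succ_apply']
    rw [h, ih]
    funext q
    rw [sliceD_hermiteSeries k (hc.smul _), pow_succ]
    have := hermiteSeries_succ k (hc.smul ((-1) ^ k)) q
    simp only [mul_neg, mul_one, neg_smul]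
    have e := hermiteSeries_smul (k + 1) (fun j => (-1 : ℝ) ^ k • c j) (-1) q
    simp only [neg_smul, one_smul] at e
    rw [e, this]
    abel

end Derivatives

/-! ### S-polyregular functions as sums of Hermite series -/

section Structure

variable {I : ℍ[ℝ]}

lemma IsSliceFunction.add {f g : ℍ[ℝ] → ℍ[ℝ]} (hf : IsSliceFunction f) (hg : IsSliceFunction g) :
    IsSliceFunction (f + g) := by
  obtain ⟨α, β, hf⟩ := hf
  obtain ⟨α', β', hg⟩ := hg
  refine ⟨α + α', β + β', fun I hI z => ?_⟩
  simp only [Pi.add_apply, hf I hI, hg I hI, mul_add]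
  abel

lemma dbarSlice_add {F G : ℂ → ℍ[ℝ]} (hF : Differentiable ℝ F) (hG : Differentiable ℝ G) :
    dbarSlice I (F + G) = dbarSlice I F + dbarSlice I G := by
  funext z
  simp only [dbarSlice, Pi.add_apply, fderiv_add (hF z) (hG z), add_apply, ← smul_add,
    mul_add]
  congr 1
  abel

lemma dbarSlice_iterate_add {F G : ℂ → ℍ[ℝ]} {n : ℕ}
    (hF : ∀ k < n, Differentiable ℝ ((dbarSlice I)^[k] F))
    (hG : ∀ k < n, Differentiable ℝ ((dbarSlice I)^[k] G)) :
    ∀ m ≤ n, (dbarSlice I)^[m] (F + G) = (dbarSlice I)^[m] F + (dbarSlice I)^[m] G := by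
  intro m hm
  induction m with
  | zero => rfl
  | succ m ih =>
    simp only [Function.iterate_succ_apply']
    rw [ih (by omega), dbarSlice_add (hF m hm) (hG m hm)]

lemma IsPolyanalytic.add {n : ℕ} {F G : ℂ → ℍ[ℝ]} (hF : IsPolyanalytic I n F)
    (hG : IsPolyanalytic I n G) : IsPolyanalytic I n (F + G) := by
  have h := dbarSlice_iterate_add (fun k (hk : k < n + 1) => hF.1 k (by omega))
    (fun k hk => hG.1 k (by omega))
  refine ⟨fun k hk => ?_, fun z => ?_⟩
  · rw [h k (by omega)]
    exact (hF.1 k hk).add (hG.1 k hk)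
  · rw [h _ le_rfl, Pi.add_apply, hF.2, hG.2, add_zero]

lemma SR_add {n : ℕ} {f g : ℍ[ℝ] → ℍ[ℝ]} (hf : f ∈ SR n) (hg : g ∈ SR n) : f + g ∈ SR n :=
  ⟨hf.1.add hg.1, hf.2.1.add hg.2.1, fun I hI => (hf.2.2 I hI).add (hg.2.2 I hI)⟩

lemma differentiable_hermiteSeries_slice (k : ℕ) {c : ℕ → ℍ[ℝ]} (hc : EntireCoeff c) :
    Differentiable ℝ (hermiteSeries k c ∘ slicePt I) :=
  (differentiable_hermiteSeries k hc).comp (slicePtL I).differentiable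

lemma dbarSlice_iterate_hermiteSeries (hI : I ^ 2 = -1) (k : ℕ) {c : ℕ → ℍ[ℝ]}
    (hc : EntireCoeff c) (m : ℕ) :
    (dbarSlice I)^[m] (hermiteSeries k c ∘ slicePt I) =
      hermiteSeries (k - m) (fun j => (k.descFactorial m : ℝ) • c j) ∘ slicePt I := by
  induction m with
  | zero => simp
  | succ m ih =>
    rw [Function.iterate_succ_apply', ih]
    funext z
    rw [dbarSlice_eq_of_hasFDerivAt hI (hasFDerivAt_hermiteSeries_slice hI _ (hc.smul _) z),
      Function.comp_apply, hermiteSeries_smul, hermiteSeries_smul, smul_smul,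
      Nat.descFactorial_succ, Nat.sub_sub]
    push_cast
    rfl

lemma isPolyanalytic_hermiteSeries (hI : I ^ 2 = -1) {k n : ℕ} (hk : k ≤ n) {c : ℕ → ℍ[ℝ]}
    (hc : EntireCoeff c) : IsPolyanalytic I n (hermiteSeries k c ∘ slicePt I) := by
  refine ⟨fun m _ => ?_, fun z => ?_⟩
  · rw [dbarSlice_iterate_hermiteSeries hI k hc]
    exact differentiable_hermiteSeries_slice _ (hc.smul _)
  · rw [dbarSlice_iterate_hermiteSeries hI k hc, Function.comp_apply, hermiteSeries_smul,
      Nat.descFactorial_eq_zero_iff_lt.2 (by omega)]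
    simp

open ComplexConjugate in
/-- The complex Hermite polynomials, defined through their recurrence; `hermiteQ j k` restricted to
any slice is `hermiteC j k`. -/
noncomputable def hermiteC (j : ℕ) : ℕ → ℂ → ℂ
  | 0, z => z ^ j
  | k + 1, z => conj z * hermiteC j k z - j * hermiteC (j - 1) k z

lemma hermiteQ_slicePt (hI : I ^ 2 = -1) (j k : ℕ) (z : ℂ) :
    hermiteQ j k (slicePt I z) = slicePt I (hermiteC j k z) := by
  induction k generalizing j with
  | zero => rw [hermiteQ_zero_right, hermiteC, slicePt_pow hI]
  | succ k ih =>
    rw [hermiteQ_succ_right, ih, ih, hermiteC, slicePt_sub, slicePt_mul hI, slicePt_conj hI,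
      ← slicePt_real_smul, Complex.real_smul, Complex.ofReal_natCast]

lemma summable_norm_hermiteC_mul (k : ℕ) {c : ℕ → ℍ[ℝ]} (hc : EntireCoeff c) (z : ℂ) :
    Summable fun j => ‖hermiteC j k z‖ * ‖c j‖ := by
  refine (summable_hermiteQ_mul k hc (slicePt unitI z)).norm.congr fun j => ?_
  rw [norm_mul, hermiteQ_slicePt unitI_sq, norm_slicePt unitI_sq]

lemma isSliceFunction_hermiteSeries (k : ℕ) {c : ℕ → ℍ[ℝ]} (hc : EntireCoeff c) :
    IsSliceFunction (hermiteSeries k c) := by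
  refine ⟨fun z => ∑' j, (hermiteC j k z).re • c j, fun z => ∑' j, (hermiteC j k z).im • c j,
    fun I hI z => ?_⟩
  have h1 : Summable fun j => (hermiteC j k z).re • c j := by
    refine Summable.of_norm_bounded (summable_norm_hermiteC_mul k hc z) fun j => ?_
    rw [norm_smul]
    gcongr
    exact Complex.abs_re_le_norm _
  have h2 : Summable fun j => (hermiteC j k z).im • c j := by
    refine Summable.of_norm_bounded (summable_norm_hermiteC_mul k hc z) fun j => ?_
    rw [norm_smul]
    gcongr
    exact Complex.abs_im_le_norm _
  refine ((h1.hasSum.add (h2.hasSum.mul_left I)).congr_terms fun j => ?_).tsum_eq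
  rw [hermiteQ_slicePt hI, slicePt, add_mul, Quaternion.coe_mul_eq_smul, smul_mul_assoc,
    mul_smul_comm]

lemma hermiteSeries_mem_SR {k n : ℕ} (hk : k ≤ n) {c : ℕ → ℍ[ℝ]} (hc : EntireCoeff c) :
    hermiteSeries k c ∈ SR n :=
  ⟨isSliceFunction_hermiteSeries k hc, differentiable_hermiteSeries k hc,
    fun _ hI => isPolyanalytic_hermiteSeries hI hk hc⟩

/-- The function `∑_{k ≤ n} ∑ⱼ H_{j,k} c_{k,j}`. -/
noncomputable def hermiteSum (n : ℕ) (c : ℕ → ℕ → ℍ[ℝ]) (q : ℍ[ℝ]) : ℍ[ℝ] :=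
  ∑ k ∈ Finset.range (n + 1), hermiteSeries k (c k) q

lemma hermiteSum_mem_SR (n : ℕ) {c : ℕ → ℕ → ℍ[ℝ]} (hc : ∀ k, EntireCoeff (c k)) :
    hermiteSum n c ∈ SR n := by
  have e : hermiteSum n c = ∑ k ∈ Finset.range (n + 1), hermiteSeries k (c k) := by
    funext q; simp [hermiteSum]
  rw [e]
  refine Finset.sum_induction_nonempty _ (· ∈ SR n) (fun _ _ => SR_add) (by simp) fun k hk => ?_
  exact hermiteSeries_mem_SR (Finset.mem_range_succ_iff.1 hk) (hc k)

lemma hasSum_taylor_of_entire {E : Type*} [NormedAddCommGroup E] [NormedSpace ℂ E]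
    [CompleteSpace E] {f : ℂ → E} (hf : Differentiable ℂ f) :
    ∃ a : ℕ → E, ∀ z, HasSum (fun m => z ^ m • a m) (f z) := by
  refine ⟨fun m => (m.factorial : ℂ)⁻¹ • iteratedDeriv m f 0, fun z => ?_⟩
  convert Complex.hasSum_taylorSeries_of_entire hf 0 z using 2 with m
  rw [sub_zero, smul_comm]

/-- A quaternion-valued function on `ℂ_I` annihilated by `∂̄_I` is an entire power series: it is
holomorphic for the complex structure on `ℍ` given by left multiplication by `I`. -/
lemma exists_hermiteSeries_zero_of_dbarSlice_eq_zero (hI : I ^ 2 = -1) {g : ℂ → ℍ[ℝ]}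
    (hg : Differentiable ℝ g) (h0 : ∀ z, dbarSlice I g z = 0) :
    ∃ c, EntireCoeff c ∧ ∀ z, g z = hermiteSeries 0 c (slicePt I z) := by
  have hII : I * I = -1 := by rw [← sq, hI]
  have key : ∃ a : ℕ → ℍ[ℝ], ∀ z, HasSum (fun m => slicePt I (z ^ m) * a m) (g z) := by
    let _ : Module ℂ ℍ[ℝ] := Module.compHom ℍ[ℝ] (Complex.liftAux I hII).toRingHom
    have hsmul : ∀ (z : ℂ) (q : ℍ[ℝ]), z • q = slicePt I z * q := fun z q => by
      rw [slicePt_eq_liftAux hI]; rfl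
    let _ : NormedSpace ℂ ℍ[ℝ] := ⟨fun z q => by rw [hsmul, norm_mul, norm_slicePt hI]⟩
    have hd : Differentiable ℂ g := fun z => by
      have hz := (hg z).hasFDerivAt
      have hC : ∀ w, fderiv ℝ g z w = w • fderiv ℝ g z 1 := by
        intro w
        have h1 : fderiv ℝ g z 1 + I * fderiv ℝ g z Complex.I = 0 := by
          have := h0 z
          rw [dbarSlice, smul_eq_zero] at this
          exact this.resolve_left (by norm_num)
        have h2 : fderiv ℝ g z Complex.I = I * fderiv ℝ g z 1 := by
          have := congrArg (I * ·) h1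
          simp only [mul_add, ← mul_assoc, hII, mul_zero, neg_mul, one_mul] at this
          exact (sub_eq_zero.1 (by rw [sub_eq_add_neg]; exact this)).symm
        have h3 : w = w.re • (1 : ℂ) + w.im • Complex.I := by
          simp
        conv_lhs => rw [h3]
        rw [map_add, map_smul, map_smul, h2, hsmul, slicePt, add_mul,
          Quaternion.coe_mul_eq_smul, smul_mul_assoc]
      have : HasDerivAt g (fderiv ℝ g z 1) z := by
        rw [hasDerivAt_iff_isLittleO]
        rw [hasFDerivAt_iff_isLittleO] at hz
        exact hz.congr_left fun x => by rw [hC (x - z)]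
      exact this.differentiableAt
    obtain ⟨a, ha⟩ := hasSum_taylor_of_entire hd
    exact ⟨a, fun z => by simpa only [hsmul] using ha z⟩
  obtain ⟨a, ha⟩ := key
  have hent : EntireCoeff a := by
    intro r hr
    refine (ha r).summable.norm.congr fun j => ?_
    rw [norm_mul, norm_slicePt hI, norm_pow, Complex.norm_of_nonneg hr]
  refine ⟨a, hent, fun z => (ha z).unique ?_⟩
  refine (hasSum_hermiteSeries 0 hent (slicePt I z)).congr_terms fun j => ?_
  rw [hermiteQ_zero_right, slicePt_pow hI]

/-- Polyanalytic functions are sums of Hermite series, by induction on the level: since `∂̄_I`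
lowers the second index, the top derivative `∂̄_I ^ n F` is `n!` times the power series underlying
the Hermite series of index `n`. -/
lemma IsPolyanalytic.exists_hermiteSum (hI : I ^ 2 = -1) {n : ℕ} {F : ℂ → ℍ[ℝ]}
    (hF : IsPolyanalytic I n F) :
    ∃ c : ℕ → ℕ → ℍ[ℝ], (∀ k, EntireCoeff (c k)) ∧ ∀ z, F z = hermiteSum n c (slicePt I z) := by
  induction n generalizing F with
  | zero =>
    obtain ⟨c, hc, h⟩ := exists_hermiteSeries_zero_of_dbarSlice_eq_zero hI (hF.1 0 le_rfl) hF.2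
    exact ⟨fun _ => c, fun _ => hc, fun z => by simpa [hermiteSum] using h z⟩
  | succ n ih =>
    obtain ⟨c, hc, h⟩ := exists_hermiteSeries_zero_of_dbarSlice_eq_zero hI (hF.1 (n + 1) le_rfl)
      (fun z => by rw [← Function.iterate_succ_apply' (dbarSlice I)]; exact hF.2 z)
    set a : ℝ := -((n + 1).factorial : ℝ)⁻¹ with ha
    have hH := isPolyanalytic_hermiteSeries hI (le_refl (n + 1)) (hc.smul a)
    have hadd := dbarSlice_iterate_add (fun k (hk : k < n + 1) => hF.1 k hk.le)
      (fun k hk => hH.1 k hk.le)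
    obtain ⟨d, hd, hFd⟩ := ih (F := F + hermiteSeries (n + 1) (fun j => a • c j) ∘ slicePt I)
      ⟨fun k hk => by
        rw [hadd k (by omega)]
        exact (hF.1 k (by omega)).add (hH.1 k (by omega)), fun z => by
        rw [hadd _ le_rfl, Pi.add_apply, h, dbarSlice_iterate_hermiteSeries hI _ (hc.smul a),
          Function.comp_apply, hermiteSeries_smul, Nat.sub_self, hermiteSeries_smul, smul_smul,
          Nat.descFactorial_self, ha, mul_neg, mul_inv_cancel₀ (by positivity), neg_smul, one_smul,
          add_neg_cancel]⟩
    refine ⟨Function.update d (n + 1) fun j => (-a) • c j, fun k => ?_, fun z => ?_⟩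
    · rcases eq_or_ne k (n + 1) with rfl | hk
      · simpa using hc.smul (-a)
      · simpa [Function.update_of_ne hk] using hd k
    · have h1 : ∀ k ∈ Finset.range (n + 1),
          hermiteSeries k (Function.update d (n + 1) (fun j => (-a) • c j) k) (slicePt I z) =
            hermiteSeries k (d k) (slicePt I z) := fun k hk => by
        rw [Function.update_of_ne (Finset.mem_range.1 hk).ne]
      rw [hermiteSum, Finset.sum_range_succ, Finset.sum_congr rfl h1, Function.update_self,
        hermiteSeries_smul, neg_smul, ← sub_eq_add_neg, eq_sub_iff_add_eq]
      have h2 := hFd z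
      rwa [Pi.add_apply, Function.comp_apply, hermiteSeries_smul] at h2

lemma exists_hermiteSum_of_mem_SR {n : ℕ} {f : ℍ[ℝ] → ℍ[ℝ]} (hf : f ∈ SR n) :
    ∃ c : ℕ → ℕ → ℍ[ℝ], (∀ k, EntireCoeff (c k)) ∧ f = hermiteSum n c := by
  obtain ⟨c, hc, h⟩ := (hf.2.2 _ unitI_sq).exists_hermiteSum unitI_sq
  exact ⟨c, hc, hf.1.ext_slice (hermiteSum_mem_SR n hc).1 unitI_sq h⟩

lemma sliceDbar_hermiteSum (n : ℕ) {c : ℕ → ℕ → ℍ[ℝ]} (hc : ∀ k, EntireCoeff (c k)) (q : ℍ[ℝ]) :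
    sliceDbar (hermiteSum n c) q =
      ∑ k ∈ Finset.range (n + 1), (k : ℝ) • hermiteSeries (k - 1) (c k) q := by
  have h := hasFDerivAt_wirtinger_sum (Finset.range (n + 1)) fun k _ =>
    hasFDerivAt_hermiteSeries_slice (sliceUnit_sq q) k (hc k) (sliceCoord q)
  rw [slicePt_sliceUnit] at h
  exact dbarSlice_eq_of_hasFDerivAt (sliceUnit_sq q) h

/-- The Hermite series of index `k` is an eigenfunction of `□_q`, for the eigenvalue `k`. -/
lemma sliceBox_hermiteSum (n : ℕ) {c : ℕ → ℕ → ℍ[ℝ]} (hc : ∀ k, EntireCoeff (c k)) (q : ℍ[ℝ]) :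
    sliceBox (hermiteSum n c) q =
      ∑ k ∈ Finset.range (n + 1), (k : ℝ) • hermiteSeries k (c k) q := by
  have e : sliceDbar (hermiteSum n c) = fun q => ∑ k ∈ Finset.range (n + 1),
      hermiteSeries (k - 1) (fun j => (k : ℝ) • c k j) q := by
    funext q
    simp only [sliceDbar_hermiteSum n hc, hermiteSeries_smul]
  have h := hasFDerivAt_wirtinger_sum (Finset.range (n + 1)) fun k _ =>
    hasFDerivAt_hermiteSeries_slice (sliceUnit_sq q) (k - 1) ((hc k).smul k) (sliceCoord q)
  rw [slicePt_sliceUnit] at h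
  have hD : sliceD (sliceDbar (hermiteSum n c)) q = ∑ k ∈ Finset.range (n + 1),
      hermiteSeries (k - 1) (dcoeff fun j => (k : ℝ) • c k j) q := by
    rw [e]
    exact dSlice_eq_of_hasFDerivAt (sliceUnit_sq q) h
  rw [sliceBox, hD, e, Finset.mul_sum, neg_add_eq_sub, ← Finset.sum_sub_distrib]
  refine Finset.sum_congr rfl fun k _ => ?_
  rcases k with _ | k
  · simp [hermiteSeries, dcoeff]
  · rw [Nat.add_sub_cancel, ← hermiteSeries_succ k ((hc (k + 1)).smul _), hermiteSeries_smul]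

end Structure

/-! ### Gaussian integrals of Hermite polynomials -/

section Gaussian

open ComplexConjugate

lemma measurable_gaussianDensity :
    Measurable fun z : ℂ => ENNReal.ofReal (Real.exp (-‖z‖ ^ 2)) := by
  fun_prop

lemma measurePreserving_rotation (ω : Circle) :
    MeasurePreserving (rotation ω) gaussianMeasure gaussianMeasure := by
  have h := (rotation ω).measurePreserving
  refine ⟨h.measurable, Measure.ext fun s hs => ?_⟩
  rw [Measure.map_apply h.measurable hs, gaussianMeasure, withDensity_apply _ (h.measurable hs),
    withDensity_apply _ hs, ← h.setLIntegral_comp_preimage hs measurable_gaussianDensity]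
  simp only [LinearIsometryEquiv.norm_map]

lemma integral_gaussianMeasure {E : Type*} [NormedAddCommGroup E] [NormedSpace ℝ E] (f : ℂ → E) :
    ∫ z, f z ∂gaussianMeasure = ∫ z : ℂ, Real.exp (-‖z‖ ^ 2) • f z := by
  rw [gaussianMeasure, integral_withDensity_eq_integral_toReal_smul measurable_gaussianDensity
    (Filter.Eventually.of_forall fun _ => ENNReal.ofReal_lt_top)]
  simp only [ENNReal.toReal_ofReal (Real.exp_nonneg _)]

lemma integrable_norm_pow (n : ℕ) : Integrable (fun z : ℂ => ‖z‖ ^ n) gaussianMeasure := by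
  rw [gaussianMeasure, integrable_withDensity_iff measurable_gaussianDensity
    (Filter.Eventually.of_forall fun _ => ENNReal.ofReal_lt_top)]
  simp only [ENNReal.toReal_ofReal (Real.exp_nonneg _)]
  rw [integrable_fun_norm_addHaar volume (f := fun x : ℝ => x ^ n * Real.exp (-x ^ 2)),
    Complex.finrank_real_complex]
  have h := integrableOn_rpow_mul_exp_neg_mul_sq (b := 1) one_pos (s := ((n + 1 : ℕ) : ℝ))
    (by linarith [Nat.cast_nonneg (α := ℝ) (n + 1)])
  refine h.congr_fun (fun x _ => ?_) measurableSet_Ioi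
  simp only [Real.rpow_natCast, smul_eq_mul]
  ring_nf

lemma integrable_of_polynomial_bound {E : Type*} [NormedAddCommGroup E] {f : ℂ → E}
    (hf : AEStronglyMeasurable f gaussianMeasure) (C : ℝ) (N : ℕ)
    (h : ∀ z, ‖f z‖ ≤ C * (1 + ‖z‖) ^ N) : Integrable f gaussianMeasure := by
  refine Integrable.mono' (g := fun z => C * (1 + ‖z‖) ^ N) (Integrable.const_mul ?_ C) hf
    (Filter.Eventually.of_forall h)
  simp only [add_comm (1 : ℝ), add_pow, one_pow, mul_one]
  exact integrable_finsetSum _ fun i _ => (integrable_norm_pow i).mul_const _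

instance : IsFiniteMeasure gaussianMeasure := by
  have h := integrable_of_polynomial_bound (f := fun _ => (1 : ℝ)) aestronglyMeasurable_const 1 0
    (by simp)
  exact (integrable_const_iff_isFiniteMeasure one_ne_zero).1 h

/-- The integral of a function of nonzero angular momentum vanishes: it is invariant under a
rotation which changes the sign of the function. -/
lemma setIntegral_eq_zero_of_rotation {s : Set ℂ} (hs : ∀ ω : Circle, rotation ω ⁻¹' s = s)
    {d : ℤ} (hd : d ≠ 0) {f : ℂ → ℂ} (hf : ∀ (ω : Circle) z, f (ω * z) = (ω : ℂ) ^ d * f z) :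
    ∫ z in s, f z ∂gaussianMeasure = 0 := by
  set ω := Circle.exp (Real.pi / d)
  have hω : (ω : ℂ) ^ d = -1 := by
    have hd' : (d : ℂ) ≠ 0 := by exact_mod_cast hd
    rw [Circle.coe_exp, ← Complex.exp_int_mul, ← Complex.exp_pi_mul_I]
    congr 1
    push_cast
    field_simp
  have h := (measurePreserving_rotation ω).setIntegral_preimage_emb
    (rotation ω).toHomeomorph.measurableEmbedding f s
  rw [hs ω] at h
  simp only [rotation_apply, hf, hω, neg_one_mul, integral_neg] at h
  exact self_eq_neg.1 h.symm

lemma integral_pow_mul_conj_pow (a b : ℕ) :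
    ∫ z, z ^ a * conj z ^ b ∂gaussianMeasure =
      if a = b then (Real.pi * a.factorial : ℂ) else 0 := by
  split_ifs with h
  · subst h
    have e : ∀ z : ℂ, z ^ a * conj z ^ a = ((‖z‖ ^ (2 * a) : ℝ) : ℂ) := fun z => by
      rw [← mul_pow, Complex.mul_conj, Complex.normSq_eq_norm_sq, pow_mul]
      push_cast; rfl
    simp only [e]
    rw [integral_complex_ofReal, integral_gaussianMeasure]
    have h := Complex.integral_rpow_mul_exp_neg_rpow (p := 2) (q := ((2 * a : ℕ) : ℝ)) one_le_two
      (by linarith [Nat.cast_nonneg (α := ℝ) (2 * a)])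
    simp only [Real.rpow_natCast, Real.rpow_two] at h
    rw [show (((2 * a : ℕ) : ℝ) + 2) / 2 = a + 1 by push_cast; ring, Real.Gamma_nat_eq_factorial]
      at h
    simp only [smul_eq_mul, mul_comm (Real.exp _), h]
    push_cast
    ring
  · rw [← setIntegral_univ]
    refine setIntegral_eq_zero_of_rotation (fun _ => rfl) (d := (a : ℤ) - b) (by omega)
      fun ω z => ?_
    rw [zpow_sub₀ ω.coe_ne_zero, zpow_natCast, zpow_natCast, map_mul, ← Circle.coe_inv_eq_conj,
      Circle.coe_inv, mul_pow, mul_pow, inv_pow]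
    field_simp

lemma continuous_hermiteC (j k : ℕ) : Continuous (hermiteC j k) := by
  induction k generalizing j with
  | zero => exact continuous_pow j
  | succ k ih =>
    exact (Complex.continuous_conj.mul (ih j)).sub (continuous_const.mul (ih (j - 1)))

lemma norm_hermiteC_le (j k : ℕ) (z : ℂ) :
    ‖hermiteC j k z‖ ≤ (1 + j) ^ k * (1 + ‖z‖) ^ (j + k) := by
  have h := norm_hermiteQ_le j k (R := 1 + ‖z‖) (by simp) (q := slicePt unitI z)
    (by rw [norm_slicePt unitI_sq]; simp)
  rw [hermiteQ_slicePt unitI_sq, norm_slicePt unitI_sq] at h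
  refine h.trans ?_
  calc (1 + ‖z‖ + j) ^ k * (1 + ‖z‖) ^ j ≤ ((1 + j) * (1 + ‖z‖)) ^ k * (1 + ‖z‖) ^ j := by
        gcongr
        nlinarith [norm_nonneg z, Nat.cast_nonneg (α := ℝ) j,
          mul_nonneg (norm_nonneg z) (Nat.cast_nonneg (α := ℝ) j)]
    _ = _ := by rw [mul_pow, pow_add]; ring

lemma integrable_monomial_mul_hermiteC (a b j k : ℕ) :
    Integrable (fun z => z ^ a * conj z ^ b * hermiteC j k z) gaussianMeasure := by
  have hc := continuous_hermiteC j k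
  refine integrable_of_polynomial_bound
    (Continuous.aestronglyMeasurable (by fun_prop)) ((1 + j) ^ k) (a + b + (j + k)) fun z => ?_
  rw [norm_mul, norm_mul, norm_pow, norm_pow, RCLike.norm_conj, ← pow_add]
  calc ‖z‖ ^ (a + b) * ‖hermiteC j k z‖
      ≤ (1 + ‖z‖) ^ (a + b) * ((1 + j) ^ k * (1 + ‖z‖) ^ (j + k)) := by
        gcongr
        · linarith
        · exact norm_hermiteC_le j k z
    _ = _ := by ring

/-- The moments of the Hermite polynomials, by induction on `k` from the recurrence. -/
lemma integral_monomial_mul_hermiteC (a b j k : ℕ) :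
    ∫ z, z ^ a * conj z ^ b * hermiteC j k z ∂gaussianMeasure =
      if a + j = b + k then (a.descFactorial k * (Real.pi * b.factorial) : ℂ) else 0 := by
  induction k generalizing b j with
  | zero =>
    have e : ∀ z : ℂ, z ^ a * conj z ^ b * hermiteC j 0 z = z ^ (a + j) * conj z ^ b := fun z => by
      rw [hermiteC]; ring
    simp only [e, integral_pow_mul_conj_pow]
    split_ifs with h1 h2 h2
    · simp [h1]
    · omega
    · omega
    · rfl
  | succ k ih =>
    have e : ∀ z : ℂ, z ^ a * conj z ^ b * hermiteC j (k + 1) z =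
        z ^ a * conj z ^ (b + 1) * hermiteC j k z
          - j * (z ^ a * conj z ^ b * hermiteC (j - 1) k z) := fun z => by
      rw [hermiteC]; ring
    simp only [e]
    rw [integral_sub (integrable_monomial_mul_hermiteC a (b + 1) j k)
      ((integrable_monomial_mul_hermiteC a b (j - 1) k).const_mul _), integral_const_mul, ih, ih]
    rcases j with _ | j
    · by_cases h : a + 0 = b + (k + 1)
      · have h' : a + 0 = b + 1 + k := by omega
        rw [if_pos h, if_pos h', Nat.descFactorial_succ, show a - k = b + 1 by omega,
          Nat.factorial_succ]
        push_cast
        ring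
      · have h' : ¬ a + 0 = b + 1 + k := by omega
        rw [if_neg h, if_neg h']
        simp
    · by_cases h : a + (j + 1) = b + (k + 1)
      · have h' : a + (j + 1) = b + 1 + k := by omega
        have h'' : a + (j + 1 - 1) = b + k := by omega
        rw [if_pos h, if_pos h', if_pos h'']
        rcases lt_or_ge a k with hak | hak
        · rw [Nat.descFactorial_eq_zero_iff_lt.2 hak,
            Nat.descFactorial_eq_zero_iff_lt.2 (by omega : a < k + 1)]
          simp
        · have hb : b = a - k + j := by omega
          rw [Nat.descFactorial_succ, Nat.factorial_succ]
          have : ((b : ℕ) : ℂ) = ((a - k : ℕ) : ℂ) + j := by rw [hb]; push_cast; rfl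
          push_cast [this]
          ring
      · have h' : ¬ a + (j + 1) = b + 1 + k := by omega
        have h'' : ¬ a + (j + 1 - 1) = b + k := by omega
        rw [if_neg h, if_neg h', if_neg h'']
        simp

lemma slicePt_injective {I : ℍ[ℝ]} (hI : I ^ 2 = -1) : Function.Injective (slicePt I) := by
  intro z w h
  rw [← sub_eq_zero, ← norm_eq_zero, ← norm_slicePt hI, slicePt_sub, h, sub_self, norm_zero]

lemma hermiteC_eq_sum_choose (j k : ℕ) (z : ℂ) :
    hermiteC j k z = ∑ i ∈ Finset.range (k + 1),
      ((-1 : ℝ) ^ i * k.choose i * j.descFactorial i) • (z ^ (j - i) * conj z ^ (k - i)) := by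
  apply slicePt_injective unitI_sq
  rw [← hermiteQ_slicePt unitI_sq, hermiteQ_eq_sum_choose]
  change _ = slicePtL unitI _
  rw [map_sum]
  refine Finset.sum_congr rfl fun i _ => ?_
  rw [map_smul, slicePtL_apply, slicePt_mul unitI_sq, slicePt_pow unitI_sq, slicePt_pow unitI_sq,
    slicePt_conj unitI_sq]

lemma integral_conj_hermiteC_mul_of_le {j k j' k' : ℕ} (hk : k ≤ k') :
    ∫ z, conj (hermiteC j k z) * hermiteC j' k' z ∂gaussianMeasure =
      if j = j' ∧ k = k' then (Real.pi * (j.factorial * k.factorial) : ℂ) else 0 := by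
  have e : ∀ z : ℂ, conj (hermiteC j k z) * hermiteC j' k' z = ∑ i ∈ Finset.range (k + 1),
      ((-1 : ℝ) ^ i * k.choose i * j.descFactorial i : ℝ) *
        (z ^ (k - i) * conj z ^ (j - i) * hermiteC j' k' z) := fun z => by
    rw [hermiteC_eq_sum_choose j k, map_sum, Finset.sum_mul]
    refine Finset.sum_congr rfl fun i _ => ?_
    rw [Complex.real_smul, map_mul, Complex.conj_ofReal, map_mul, map_pow, map_pow,
      Complex.conj_conj]
    ring
  simp only [e]
  rw [integral_finsetSum _ fun i _ => (integrable_monomial_mul_hermiteC _ _ _ _).const_mul _]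
  simp only [integral_const_mul, integral_monomial_mul_hermiteC]
  -- all the terms but the one with `i = 0` vanish because `k - i < k'`
  rw [Finset.sum_range_succ', Finset.sum_eq_zero, zero_add]
  · rcases hk.lt_or_eq with h | rfl
    · rw [if_neg (c := j = j' ∧ k = k') (by omega), tsub_zero,
        Nat.descFactorial_eq_zero_iff_lt.2 h]
      simp
    · by_cases h : j = j'
      · subst h
        simp [add_comm, Nat.descFactorial_self]
        ring
      · rw [if_neg (by omega), if_neg (by tauto), mul_zero]
  · intro i hi
    have := Finset.mem_range.1 hi
    rw [Nat.descFactorial_eq_zero_iff_lt.2 (by omega : k - (i + 1) < k')]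
    simp

/-- Orthogonality of the complex Hermite polynomials. -/
lemma integral_conj_hermiteC_mul (j k j' k' : ℕ) :
    ∫ z, conj (hermiteC j k z) * hermiteC j' k' z ∂gaussianMeasure =
      if j = j' ∧ k = k' then (Real.pi * (j.factorial * k.factorial) : ℂ) else 0 := by
  rcases le_total k k' with hk | hk
  · exact integral_conj_hermiteC_mul_of_le hk
  · have e : ∀ z : ℂ, conj (hermiteC j k z) * hermiteC j' k' z =
        conj (conj (hermiteC j' k' z) * hermiteC j k z) := fun z => by
      rw [map_mul, Complex.conj_conj, mul_comm]
    simp only [e]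
    rw [integral_conj, integral_conj_hermiteC_mul_of_le hk]
    by_cases h : j = j' ∧ k = k'
    · rw [if_pos h, if_pos (by tauto), h.1, h.2]
      simp
    · rw [if_neg h, if_neg (by tauto), map_zero]

lemma hermiteC_circle_mul (j k : ℕ) (ω : Circle) (z : ℂ) :
    hermiteC j k (ω * z) = (ω : ℂ) ^ ((j : ℤ) - k) * hermiteC j k z := by
  have hω := ω.coe_ne_zero
  induction k generalizing j with
  | zero => simp [hermiteC, mul_pow]
  | succ k ih =>
    rw [hermiteC, hermiteC, ih, ih, map_mul, ← Circle.coe_inv_eq_conj, Circle.coe_inv,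
      show ((j : ℤ) - (k + 1 : ℕ)) = (j - k : ℤ) - 1 by push_cast; ring, zpow_sub_one₀ hω]
    rcases j with _ | j
    · simp; ring
    · rw [show (((j + 1 - 1 : ℕ) : ℤ) - k) = ((j + 1 : ℕ) - k : ℤ) - 1 by omega,
        zpow_sub_one₀ hω]
      ring

/-- On discs, only Hermite polynomials of the same angular momentum fail to be orthogonal. -/
lemma setIntegral_ball_conj_hermiteC_mul {j k j' k' : ℕ} (h : j + k' ≠ j' + k) (R : ℝ) :
    ∫ z in Metric.ball 0 R, conj (hermiteC j k z) * hermiteC j' k' z ∂gaussianMeasure = 0 := by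
  refine setIntegral_eq_zero_of_rotation (fun ω => ?_) (d := (j' - k' : ℤ) - (j - k)) (by omega)
    fun ω z => ?_
  · ext z
    simp only [Set.mem_preimage, mem_ball_zero_iff, LinearIsometryEquiv.norm_map]
  · have hω := ω.coe_ne_zero
    rw [hermiteC_circle_mul, hermiteC_circle_mul, map_mul, map_zpow₀, ← Circle.coe_inv_eq_conj,
      Circle.coe_inv, zpow_sub₀ hω (j' - k' : ℤ), inv_zpow, div_eq_mul_inv]
    ring

end Gaussian

/-! ### The orthogonal system of Hermite polynomials in the Gaussian space of a slice -/

section L2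

open ComplexConjugate

variable {I : ℍ[ℝ]}

lemma re_mul_comm (a b : ℍ[ℝ]) : (a * b).re = (b * a).re := by
  simp only [Quaternion.re_mul]; ring

/-- The real inner product on `ℍ` in terms of the complex product on a slice. -/
lemma inner_slicePt_mul (hI : I ^ 2 = -1) (u v : ℂ) (a b : ℍ[ℝ]) :
    inner ℝ (slicePt I u * a) (slicePt I v * b) =
      (conj u * v).re * inner ℝ a b + (conj u * v).im * inner ℝ a (I * b) := by
  have h1 : (slicePt I u * a * (star b * star (slicePt I v))).re =
      (slicePt I (conj v * u) * (a * star b)).re := by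
    rw [← mul_assoc, re_mul_comm, slicePt_mul hI, slicePt_conj hI]
    simp only [mul_assoc]
  have h2 : (a * star (I * b)).re = -(I * (a * star b)).re := by
    rw [star_mul, star_eq_neg_of_sq hI, ← mul_assoc, re_mul_comm, neg_mul, Quaternion.re_neg]
  rw [Quaternion.inner_def, Quaternion.inner_def, Quaternion.inner_def, star_mul, h1, h2, slicePt,
    add_mul, Quaternion.re_add, Quaternion.coe_mul_eq_smul, smul_mul_assoc, Quaternion.re_smul,
    Quaternion.re_smul, smul_eq_mul, smul_eq_mul]
  simp only [Complex.mul_re, Complex.mul_im, Complex.conj_re, Complex.conj_im]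
  ring

lemma integrable_conj_hermiteC_mul (j k j' k' : ℕ) :
    Integrable (fun z => conj (hermiteC j k z) * hermiteC j' k' z) gaussianMeasure := by
  have hc := continuous_hermiteC j k
  have hc' := continuous_hermiteC j' k'
  refine integrable_of_polynomial_bound (Continuous.aestronglyMeasurable (by fun_prop))
    ((1 + j) ^ k * (1 + j') ^ k') (j + k + (j' + k')) fun z => ?_
  rw [norm_mul, RCLike.norm_conj]
  calc _ ≤ ((1 + j) ^ k * (1 + ‖z‖) ^ (j + k)) * ((1 + j') ^ k' * (1 + ‖z‖) ^ (j' + k')) :=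
        mul_le_mul (norm_hermiteC_le j k z) (norm_hermiteC_le j' k' z) (norm_nonneg _)
          (by positivity)
    _ = _ := by ring

lemma inner_hermiteQ_slicePt (hI : I ^ 2 = -1) (j k j' k' : ℕ) (a b : ℍ[ℝ]) (z : ℂ) :
    inner ℝ (hermiteQ j k (slicePt I z) * a) (hermiteQ j' k' (slicePt I z) * b) =
      (conj (hermiteC j k z) * hermiteC j' k' z).re * inner ℝ a b +
        (conj (hermiteC j k z) * hermiteC j' k' z).im * inner ℝ a (I * b) := by
  rw [hermiteQ_slicePt hI, hermiteQ_slicePt hI, inner_slicePt_mul hI]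

lemma integrable_inner_hermiteQ (hI : I ^ 2 = -1) (j k j' k' : ℕ) (a b : ℍ[ℝ]) :
    Integrable (fun z => inner ℝ (hermiteQ j k (slicePt I z) * a)
      (hermiteQ j' k' (slicePt I z) * b)) gaussianMeasure := by
  simp only [inner_hermiteQ_slicePt hI]
  have h := integrable_conj_hermiteC_mul j k j' k'
  exact (h.re.mul_const _).add (h.im.mul_const _)

lemma setIntegral_inner_hermiteQ (hI : I ^ 2 = -1) (j k j' k' : ℕ) (a b : ℍ[ℝ]) (s : Set ℂ) :
    ∫ z in s, inner ℝ (hermiteQ j k (slicePt I z) * a)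
        (hermiteQ j' k' (slicePt I z) * b) ∂gaussianMeasure =
      (∫ z in s, conj (hermiteC j k z) * hermiteC j' k' z ∂gaussianMeasure).re * inner ℝ a b +
        (∫ z in s, conj (hermiteC j k z) * hermiteC j' k' z ∂gaussianMeasure).im *
          inner ℝ a (I * b) := by
  have h := (integrable_conj_hermiteC_mul j k j' k').integrableOn (s := s)
  have hre : ∫ z in s, (conj (hermiteC j k z) * hermiteC j' k' z).re ∂gaussianMeasure =
      (∫ z in s, conj (hermiteC j k z) * hermiteC j' k' z ∂gaussianMeasure).re := integral_re h
  have him : ∫ z in s, (conj (hermiteC j k z) * hermiteC j' k' z).im ∂gaussianMeasure =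
      (∫ z in s, conj (hermiteC j k z) * hermiteC j' k' z ∂gaussianMeasure).im := integral_im h
  have hre' : Integrable (fun z => (conj (hermiteC j k z) * hermiteC j' k' z).re)
      (gaussianMeasure.restrict s) := h.re
  have him' : Integrable (fun z => (conj (hermiteC j k z) * hermiteC j' k' z).im)
      (gaussianMeasure.restrict s) := h.im
  simp only [inner_hermiteQ_slicePt hI]
  rw [integral_add (hre'.mul_const _) (him'.mul_const _), integral_mul_const, integral_mul_const,
    hre, him]

/-- The squared norm of `H_{j,k}` in the Gaussian space, for `p = (j, k)`. -/
noncomputable def hermiteWeight (p : ℕ × ℕ) : ℝ := Real.pi * (p.1.factorial * p.2.factorial)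

lemma hermiteWeight_pos (p : ℕ × ℕ) : 0 < hermiteWeight p := by
  unfold hermiteWeight; positivity

lemma integral_inner_hermiteQ (hI : I ^ 2 = -1) (p p' : ℕ × ℕ) (a b : ℍ[ℝ]) :
    ∫ z, inner ℝ (hermiteQ p.1 p.2 (slicePt I z) * a)
        (hermiteQ p'.1 p'.2 (slicePt I z) * b) ∂gaussianMeasure =
      if p = p' then hermiteWeight p * inner ℝ a b else 0 := by
  rw [← setIntegral_univ, setIntegral_inner_hermiteQ hI, setIntegral_univ,
    integral_conj_hermiteC_mul]
  have e : (p.1 = p'.1 ∧ p.2 = p'.2) ↔ p = p' := Prod.ext_iff.symm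
  simp only [e]
  split_ifs with h
  · have : (Real.pi * (p.1.factorial * p.2.factorial) : ℂ) = (hermiteWeight p : ℝ) := by
      simp [hermiteWeight]
    rw [this, Complex.ofReal_re, Complex.ofReal_im]
    ring
  · simp

lemma continuous_hermiteQ_slicePt (hI : I ^ 2 = -1) (j k : ℕ) :
    Continuous fun z => hermiteQ j k (slicePt I z) := by
  simp only [hermiteQ_slicePt hI]
  exact continuous_slicePt.comp (continuous_hermiteC j k)

lemma memLp_hermiteQ_mul (hI : I ^ 2 = -1) (p : ℕ × ℕ) (a : ℍ[ℝ]) :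
    MemLp (fun z => hermiteQ p.1 p.2 (slicePt I z) * a) 2 gaussianMeasure := by
  have hc : Continuous fun z => hermiteQ p.1 p.2 (slicePt I z) * a :=
    (continuous_hermiteQ_slicePt hI p.1 p.2).mul continuous_const
  rw [memLp_two_iff_integrable_sq_norm hc.aestronglyMeasurable]
  simpa only [real_inner_self_eq_norm_sq] using integrable_inner_hermiteQ hI p.1 p.2 p.1 p.2 a a

/-- The class of `H_{j,k} a` in the Gaussian space of the slice `ℂ_I`, for `p = (j, k)`, as a
real linear function of `a`. -/
noncomputable def hermiteLp (hI : I ^ 2 = -1) (p : ℕ × ℕ) :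
    ℍ[ℝ] →ₗ[ℝ] Lp ℍ[ℝ] 2 gaussianMeasure where
  toFun a := (memLp_hermiteQ_mul hI p a).toLp _
  map_add' a b := by
    rw [← MemLp.toLp_add]
    exact MemLp.toLp_congr _ _ (Filter.Eventually.of_forall fun z => mul_add _ _ _)
  map_smul' r a := by
    rw [RingHom.id_apply, ← MemLp.toLp_const_smul]
    exact MemLp.toLp_congr _ _ (Filter.Eventually.of_forall fun z => mul_smul_comm _ _ _)

lemma coeFn_hermiteLp (hI : I ^ 2 = -1) (p : ℕ × ℕ) (a : ℍ[ℝ]) :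
    (hermiteLp hI p a : ℂ → ℍ[ℝ]) =ᵐ[gaussianMeasure]
      fun z => hermiteQ p.1 p.2 (slicePt I z) * a :=
  MemLp.coeFn_toLp (memLp_hermiteQ_mul hI p a)

lemma inner_hermiteLp (hI : I ^ 2 = -1) (p p' : ℕ × ℕ) (a b : ℍ[ℝ]) :
    inner ℝ (hermiteLp hI p a) (hermiteLp hI p' b) =
      if p = p' then hermiteWeight p * inner ℝ a b else 0 := by
  rw [L2.inner_def, ← integral_inner_hermiteQ hI]
  refine integral_congr_ae ?_
  filter_upwards [coeFn_hermiteLp hI p a, coeFn_hermiteLp hI p' b] with z h1 h2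
  rw [h1, h2]

/-- The normalization of `hermiteLp`, an isometric embedding of `ℍ`. -/
noncomputable def hermiteIsometry (hI : I ^ 2 = -1) (p : ℕ × ℕ) :
    ℍ[ℝ] →ₗᵢ[ℝ] Lp ℍ[ℝ] 2 gaussianMeasure where
  toLinearMap := (√(hermiteWeight p))⁻¹ • hermiteLp hI p
  norm_map' a := by
    have h := inner_hermiteLp hI p p a a
    rw [if_pos rfl, real_inner_self_eq_norm_sq, real_inner_self_eq_norm_sq,
      ← Real.sq_sqrt (hermiteWeight_pos p).le, ← mul_pow] at h
    have h' := (pow_left_inj₀ (norm_nonneg _) (by positivity) two_ne_zero).1 h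
    have hw : √(hermiteWeight p) ≠ 0 := (Real.sqrt_pos.2 (hermiteWeight_pos p)).ne'
    rw [LinearMap.smul_apply, norm_smul, h', norm_inv, Real.norm_of_nonneg (Real.sqrt_nonneg _),
      inv_mul_cancel_left₀ hw]

lemma hermiteIsometry_apply (hI : I ^ 2 = -1) (p : ℕ × ℕ) (a : ℍ[ℝ]) :
    hermiteIsometry hI p a = (√(hermiteWeight p))⁻¹ • hermiteLp hI p a := rfl

lemma hermiteLp_eq_hermiteIsometry (hI : I ^ 2 = -1) (p : ℕ × ℕ) (a : ℍ[ℝ]) :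
    hermiteLp hI p a = hermiteIsometry hI p (√(hermiteWeight p) • a) := by
  rw [map_smul, hermiteIsometry_apply, smul_smul,
    mul_inv_cancel₀ (Real.sqrt_pos.2 (hermiteWeight_pos p)).ne', one_smul]

lemma orthogonalFamily_hermiteIsometry (hI : I ^ 2 = -1) :
    OrthogonalFamily ℝ (fun _ : ℕ × ℕ => ℍ[ℝ]) (hermiteIsometry hI) := by
  intro p p' hp a b
  rw [hermiteIsometry_apply, hermiteIsometry_apply, inner_smul_left, inner_smul_right,
    inner_hermiteLp, if_neg hp, mul_zero, mul_zero]

/-- `c` is the sequence of coefficients of a power series in the slice Bargmann space. -/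
def BargmannCoeff (c : ℕ → ℍ[ℝ]) : Prop := Summable fun j => (j.factorial : ℝ) * ‖c j‖ ^ 2

lemma BargmannCoeff.entireCoeff {c : ℕ → ℍ[ℝ]} (hc : BargmannCoeff c) : EntireCoeff c := by
  intro r hr
  refine Summable.of_nonneg_of_le (fun j => by positivity) (fun j => ?_)
    ((Real.summable_pow_div_factorial (r ^ 2)).add hc)
  -- the inequality of arithmetic and geometric means for `r ^ (2 j) / j!` and `j! ‖c j‖ ^ 2`
  have hf : (0 : ℝ) < j.factorial := by positivity
  have h2 : (r ^ 2) ^ j / j.factorial + j.factorial * ‖c j‖ ^ 2 - 2 * (r ^ j * ‖c j‖) =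
      (r ^ j - j.factorial * ‖c j‖) ^ 2 / j.factorial := by
    field_simp
    ring
  have h3 : 0 ≤ (r ^ j - j.factorial * ‖c j‖) ^ 2 / j.factorial := by positivity
  have h4 : 0 ≤ r ^ j * ‖c j‖ := by positivity
  linarith

lemma BargmannCoeff.smul {c : ℕ → ℍ[ℝ]} (hc : BargmannCoeff c) (a : ℝ) :
    BargmannCoeff fun j => a • c j := by
  refine (Summable.mul_left (a ^ 2) hc).congr fun j => ?_
  rw [norm_smul, mul_pow, Real.norm_eq_abs, sq_abs]
  ring

lemma bargmannCoeff_single (j : ℕ) (a : ℍ[ℝ]) : BargmannCoeff (Pi.single j a) := by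
  refine summable_of_ne_finset_zero (s := {j}) fun b hb => ?_
  rw [Pi.single_eq_of_ne (by simpa using hb), norm_zero]
  ring

lemma BargmannCoeff.summable_hermiteLp (hI : I ^ 2 = -1) (k : ℕ) {c : ℕ → ℍ[ℝ]}
    (hc : BargmannCoeff c) : Summable fun j => hermiteLp hI (j, k) (c j) := by
  have hV := (orthogonalFamily_hermiteIsometry hI).comp
    (γ := ℕ) (f := fun j => (j, k)) fun _ _ h => (Prod.ext_iff.1 h).1
  have h := (hV.summable_iff_norm_sq_summable fun j => √(hermiteWeight (j, k)) • c j).2 (by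
    refine (hc.mul_left (Real.pi * k.factorial)).congr fun j => ?_
    rw [norm_smul, mul_pow, Real.norm_of_nonneg (Real.sqrt_nonneg _),
      Real.sq_sqrt (hermiteWeight_pos _).le, hermiteWeight]
    ring)
  simpa only [hermiteLp_eq_hermiteIsometry] using h

/-- A Hermite series converges in the Gaussian space to the class of its pointwise sum. -/
lemma BargmannCoeff.exists_hasSum_hermiteLp (hI : I ^ 2 = -1) (k : ℕ) {c : ℕ → ℍ[ℝ]}
    (hc : BargmannCoeff c) :
    ∃ t : Lp ℍ[ℝ] 2 gaussianMeasure, HasSum (fun j => hermiteLp hI (j, k) (c j)) t ∧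
      (t : ℂ → ℍ[ℝ]) =ᵐ[gaussianMeasure] hermiteSeries k c ∘ slicePt I := by
  obtain ⟨t, ht⟩ := hc.summable_hermiteLp hI k
  refine ⟨t, ht, ?_⟩
  obtain ⟨ns, hns, hlim⟩ :=
    (tendstoInMeasure_of_tendsto_Lp ht.tendsto_sum_nat).exists_seq_tendsto_ae
  have hpart : ∀ N, ((∑ j ∈ Finset.range N, hermiteLp hI (j, k) (c j) :
      Lp ℍ[ℝ] 2 gaussianMeasure) : ℂ → ℍ[ℝ]) =ᵐ[gaussianMeasure]
        fun z => ∑ j ∈ Finset.range N, hermiteQ j k (slicePt I z) * c j := by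
    intro N
    induction N with
    | zero =>
      simp only [Finset.range_zero, Finset.sum_empty]
      exact Lp.coeFn_zero _ _ _
    | succ N ih =>
      rw [Finset.sum_range_succ]
      filter_upwards [ih, coeFn_hermiteLp hI (N, k) (c N), Lp.coeFn_add
        (∑ j ∈ Finset.range N, hermiteLp hI (j, k) (c j)) (hermiteLp hI (N, k) (c N))]
        with z h1 h2 h3
      rw [h3, Pi.add_apply, h1, h2, Finset.sum_range_succ]
  filter_upwards [hlim, ae_all_iff.2 hpart] with z h1 h2
  simp only [h2] at h1
  exact tendsto_nhds_unique h1
    ((hasSum_hermiteSeries k hc.entireCoeff (slicePt I z)).tendsto_sum_nat.comp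
      hns.tendsto_atTop)

/-- `c` is the sequence of coefficients of `g` along the polynomials `H_{j,k}`, `j ≥ 0`. -/
def IsHermiteCoeff (hI : I ^ 2 = -1) (g : Lp ℍ[ℝ] 2 gaussianMeasure) (k : ℕ) (c : ℕ → ℍ[ℝ]) :
    Prop :=
  ∀ j a, inner ℝ (hermiteLp hI (j, k) a) g = hermiteWeight (j, k) * inner ℝ a (c j)

lemma exists_isHermiteCoeff (hI : I ^ 2 = -1) (g : Lp ℍ[ℝ] 2 gaussianMeasure) (k : ℕ) :
    ∃ c, IsHermiteCoeff hI g k c := by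
  refine ⟨fun j => (√(hermiteWeight (j, k)))⁻¹ • ContinuousLinearMap.adjoint
    (hermiteIsometry hI (j, k)).toContinuousLinearMap g, fun j a => ?_⟩
  have h := ContinuousLinearMap.adjoint_inner_right
    (hermiteIsometry hI (j, k)).toContinuousLinearMap a g
  rw [hermiteLp_eq_hermiteIsometry, map_smul, real_inner_smul_left, real_inner_smul_right, h,
    ← mul_assoc, ← div_eq_mul_inv, Real.div_sqrt]
  rfl

/-- Bessel's inequality. -/
lemma IsHermiteCoeff.bargmannCoeff {hI : I ^ 2 = -1} {g : Lp ℍ[ℝ] 2 gaussianMeasure} {k : ℕ}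
    {c : ℕ → ℍ[ℝ]} (hc : IsHermiteCoeff hI g k c) : BargmannCoeff c := by
  have hw : ∀ j, hermiteWeight (j, k) * ‖c j‖ ^ 2 =
      Real.pi * k.factorial * (j.factorial * ‖c j‖ ^ 2) := fun j => by
    rw [hermiteWeight]; ring
  have key : Summable fun j => hermiteWeight (j, k) * ‖c j‖ ^ 2 := by
    refine summable_of_sum_range_le (c := ‖g‖ ^ 2)
      (fun j => mul_nonneg (hermiteWeight_pos _).le (sq_nonneg _)) fun N => ?_
    set s := ∑ j ∈ Finset.range N, hermiteLp hI (j, k) (c j) with hs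
    have h1 : inner ℝ s g = ∑ j ∈ Finset.range N, hermiteWeight (j, k) * ‖c j‖ ^ 2 := by
      rw [hs, sum_inner]
      refine Finset.sum_congr rfl fun j _ => ?_
      rw [hc j, real_inner_self_eq_norm_sq]
    have h2 : ‖s‖ ^ 2 = ∑ j ∈ Finset.range N, hermiteWeight (j, k) * ‖c j‖ ^ 2 := by
      rw [← real_inner_self_eq_norm_sq]
      nth_rewrite 1 [hs]
      rw [sum_inner]
      refine Finset.sum_congr rfl fun j hj => ?_
      rw [hs, inner_sum, Finset.sum_eq_single j]
      · rw [inner_hermiteLp, if_pos rfl, real_inner_self_eq_norm_sq]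
      · intro i _ hij
        rw [inner_hermiteLp, if_neg (by simpa using hij.symm)]
      · exact fun h => absurd hj h
    have h3 := real_inner_le_norm s g
    rw [h1, ← h2] at h3
    rw [← h2]
    nlinarith [norm_nonneg s, norm_nonneg g, sq_nonneg (‖s‖ - ‖g‖)]
  refine (key.mul_left (Real.pi * k.factorial)⁻¹).congr fun j => ?_
  rw [hw, inv_mul_cancel_left₀ (by positivity)]

end L2

/-! ### Coefficients of S-polyregular functions in the Gaussian space -/

section Coefficients

variable {I : ℍ[ℝ]}

/-- The only term of the Hermite series `∑ᵢ H_{i,k'} c_i` with the same angular momentum `j - k` as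
`H_{j,k}`, if there is one. -/
noncomputable def angularTerm (j k k' : ℕ) (c : ℕ → ℍ[ℝ]) (q : ℍ[ℝ]) : ℍ[ℝ] :=
  if k ≤ j + k' then hermiteQ (j + k' - k) k' q * c (j + k' - k) else 0

lemma integrable_inner_angularTerm (hI : I ^ 2 = -1) (j k k' : ℕ) (c : ℕ → ℍ[ℝ]) (a : ℍ[ℝ]) :
    Integrable (fun z => inner ℝ (hermiteQ j k (slicePt I z) * a)
      (angularTerm j k k' c (slicePt I z))) gaussianMeasure := by
  unfold angularTerm
  split_ifs
  · exact integrable_inner_hermiteQ hI _ _ _ _ _ _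
  · simp

/-- On a disc, pairing a Hermite series with `H_{j,k} a` selects a single term. -/
lemma setIntegral_inner_hermiteSeries (hI : I ^ 2 = -1) (j k k' : ℕ) {c : ℕ → ℍ[ℝ]}
    (hc : EntireCoeff c) (a : ℍ[ℝ]) (R : ℝ) :
    ∫ z in Metric.ball 0 R, inner ℝ (hermiteQ j k (slicePt I z) * a)
        (hermiteSeries k' c (slicePt I z)) ∂gaussianMeasure =
      ∫ z in Metric.ball 0 R, inner ℝ (hermiteQ j k (slicePt I z) * a)
        (angularTerm j k k' c (slicePt I z)) ∂gaussianMeasure := by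
  set r := 1 + |R| with hr_def
  have hr : 1 ≤ r := by simp [hr_def]
  set M := (r + j) ^ k * r ^ j * ‖a‖ with hM
  have hsum := summable_hermiteBound k' hc hr
  have hnorm : ∀ z ∈ Metric.ball (0 : ℂ) R, ‖slicePt I z‖ ≤ r := fun z hz => by
    rw [norm_slicePt hI, hr_def]
    linarith [mem_ball_zero_iff.1 hz, le_abs_self R]
  have hS := hasSum_integral_of_dominated_convergence
    (μ := gaussianMeasure.restrict (Metric.ball 0 R))
    (F := fun i z => inner ℝ (hermiteQ j k (slicePt I z) * a) (hermiteQ i k' (slicePt I z) * c i))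
    (f := fun z => inner ℝ (hermiteQ j k (slicePt I z) * a) (hermiteSeries k' c (slicePt I z)))
    (fun i _ => M * hermiteBound k' c r i)
    (fun i => (integrable_inner_hermiteQ hI j k i k' a (c i)).aestronglyMeasurable.restrict)
    (fun i => by
      filter_upwards [ae_restrict_mem Metric.isOpen_ball.measurableSet] with z hz
      refine (norm_inner_le_norm _ _).trans
        (mul_le_mul ?_ (norm_hermiteQ_mul_le i k' c hr (hnorm z hz)) (norm_nonneg _)
          (by positivity))
      rw [norm_mul, hM]
      gcongr
      exact norm_hermiteQ_le j k hr (hnorm z hz))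
    (Filter.Eventually.of_forall fun _ => hsum.mul_left M)
    (integrable_const _)
    (Filter.Eventually.of_forall fun z => (hasSum_hermiteSeries k' hc (slicePt I z)).mapL
      (innerSL ℝ (hermiteQ j k (slicePt I z) * a)))
  have hzero : ∀ i, j + k' ≠ i + k → ∫ z in Metric.ball 0 R,
      inner ℝ (hermiteQ j k (slicePt I z) * a) (hermiteQ i k' (slicePt I z) * c i)
        ∂gaussianMeasure = 0 := fun i hi => by
    rw [setIntegral_inner_hermiteQ hI, setIntegral_ball_conj_hermiteC_mul hi]
    simp
  refine hS.unique ?_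
  by_cases h : k ≤ j + k'
  · simp only [angularTerm, if_pos h]
    exact hasSum_single (j + k' - k) fun i hi => hzero i (by omega)
  · simp only [angularTerm, if_neg h, inner_zero_right, integral_zero]
    rw [funext fun i => hzero i (by omega)]
    exact hasSum_zero

lemma integral_inner_angularTerm (hI : I ^ 2 = -1) (j k k' : ℕ) (c : ℕ → ℍ[ℝ]) (a : ℍ[ℝ]) :
    ∫ z, inner ℝ (hermiteQ j k (slicePt I z) * a) (angularTerm j k k' c (slicePt I z))
        ∂gaussianMeasure =
      if k = k' then hermiteWeight (j, k) * inner ℝ a (c j) else 0 := by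
  by_cases h : k ≤ j + k'
  · simp only [angularTerm, if_pos h]
    rw [integral_inner_hermiteQ hI (j, k) (j + k' - k, k')]
    by_cases hk : k = k'
    · subst hk
      simp
    · rw [if_neg hk, if_neg (by simp [hk])]
  · simp only [angularTerm, if_neg h, inner_zero_right, integral_zero]
    rw [if_neg (by omega)]

lemma continuous_hermiteSeries_slice (k : ℕ) {c : ℕ → ℍ[ℝ]} (hc : EntireCoeff c) :
    Continuous fun z => hermiteSeries k c (slicePt I z) :=
  (differentiable_hermiteSeries k hc).continuous.comp continuous_slicePt

lemma integrableOn_inner_hermiteSeries (hI : I ^ 2 = -1) (j k k' : ℕ) {c : ℕ → ℍ[ℝ]}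
    (hc : EntireCoeff c) (a : ℍ[ℝ]) (R : ℝ) :
    IntegrableOn (fun z => inner ℝ (hermiteQ j k (slicePt I z) * a)
      (hermiteSeries k' c (slicePt I z))) (Metric.ball 0 R) gaussianMeasure := by
  have h1 : Continuous fun z => hermiteQ j k (slicePt I z) * a :=
    (continuous_hermiteQ_slicePt hI j k).mul continuous_const
  have h2 := h1.inner (𝕜 := ℝ) (continuous_hermiteSeries_slice (I := I) k' hc)
  exact (h2.continuousOn.integrableOn_compact (isCompact_closedBall 0 R)).mono_set
    Metric.ball_subset_closedBall

/-- The coefficients of a square integrable sum of Hermite series are its coefficients with respect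
to the orthogonal system of Hermite polynomials. As term-by-term integration is only available on
discs, the inner products are computed as limits of integrals over discs. -/
lemma isHermiteCoeff_of_ae_eq_hermiteSum (hI : I ^ 2 = -1) {n : ℕ} {c : ℕ → ℕ → ℍ[ℝ]}
    (hc : ∀ k, EntireCoeff (c k)) {g : Lp ℍ[ℝ] 2 gaussianMeasure}
    (hg : (g : ℂ → ℍ[ℝ]) =ᵐ[gaussianMeasure] hermiteSum n c ∘ slicePt I) {k : ℕ} (hk : k ≤ n) :
    IsHermiteCoeff hI g k (c k) := by
  intro j a
  have hae : (fun z => inner ℝ ((hermiteLp hI (j, k) a : ℂ → ℍ[ℝ]) z) ((g : ℂ → ℍ[ℝ]) z))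
      =ᵐ[gaussianMeasure] fun z => ∑ k' ∈ Finset.range (n + 1),
        inner ℝ (hermiteQ j k (slicePt I z) * a) (hermiteSeries k' (c k') (slicePt I z)) := by
    filter_upwards [hg, coeFn_hermiteLp hI (j, k) a] with z h1 h2
    rw [h1, h2, Function.comp_apply, hermiteSum, inner_sum]
  have hint := (L2.integrable_inner (𝕜 := ℝ) (hermiteLp hI (j, k) a) g).congr hae
  have hcover : AECover gaussianMeasure Filter.atTop fun N : ℕ => Metric.ball (0 : ℂ) N :=
    aecover_ball tendsto_natCast_atTop_atTop
  have hl := hcover.integral_tendsto_of_countably_generated hint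
  have hr := hcover.integral_tendsto_of_countably_generated
    (integrable_finsetSum (Finset.range (n + 1)) fun k' _ =>
      integrable_inner_angularTerm hI j k k' (c k') a)
  have heq : ∀ N : ℕ, ∫ z in Metric.ball (0 : ℂ) N, ∑ k' ∈ Finset.range (n + 1),
        inner ℝ (hermiteQ j k (slicePt I z) * a) (hermiteSeries k' (c k') (slicePt I z))
          ∂gaussianMeasure =
      ∫ z in Metric.ball (0 : ℂ) N, ∑ k' ∈ Finset.range (n + 1),
        inner ℝ (hermiteQ j k (slicePt I z) * a) (angularTerm j k k' (c k') (slicePt I z))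
          ∂gaussianMeasure := fun N => by
    rw [integral_finsetSum _ fun k' _ => integrableOn_inner_hermiteSeries hI j k k' (hc k') a N,
      integral_finsetSum _ fun k' _ =>
        (integrable_inner_angularTerm hI j k k' (c k') a).integrableOn]
    exact Finset.sum_congr rfl fun k' _ => setIntegral_inner_hermiteSeries hI j k k' (hc k') a N
  simp only [heq] at hl
  rw [L2.inner_def, integral_congr_ae hae, tendsto_nhds_unique hl hr,
    integral_finsetSum _ fun k' _ => integrable_inner_angularTerm hI j k k' (c k') a]
  simp only [integral_inner_angularTerm hI]
  rw [Finset.sum_ite_eq, if_pos (Finset.mem_range_succ_iff.2 hk)]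

lemma exists_bargmannCoeff_of_mem_SR2 (hI : I ^ 2 = -1) {n : ℕ} {f : ℍ[ℝ] → ℍ[ℝ]}
    (hf : f ∈ SR2 I n) :
    ∃ c : ℕ → ℕ → ℍ[ℝ], (∀ k, BargmannCoeff (c k)) ∧ f = hermiteSum n c := by
  obtain ⟨c, hc, rfl⟩ := exists_hermiteSum_of_mem_SR hf.1
  refine ⟨fun k => if k ≤ n then c k else 0, fun k => ?_, ?_⟩
  · dsimp only
    split_ifs with hk
    · exact (isHermiteCoeff_of_ae_eq_hermiteSum hI hc hf.2.coeFn_toLp hk).bargmannCoeff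
    · simp [BargmannCoeff]
  · funext q
    refine Finset.sum_congr rfl fun k hk => ?_
    dsimp only
    rw [if_pos (Finset.mem_range_succ_iff.1 hk)]

lemma hermiteLp_mem_hermiteSpan (hI : I ^ 2 = -1) {n j k : ℕ} (hk : k ≤ n) (a : ℍ[ℝ]) :
    hermiteLp hI (j, k) a ∈ hermiteSpan I n :=
  Submodule.subset_span ⟨j, k, a, hk, coeFn_hermiteLp hI (j, k) a⟩

lemma exists_mem_closure_ae_eq_hermiteSum (hI : I ^ 2 = -1) (n : ℕ) {c : ℕ → ℕ → ℍ[ℝ]}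
    (hc : ∀ k, BargmannCoeff (c k)) :
    ∃ t ∈ (hermiteSpan I n).topologicalClosure,
      (t : ℂ → ℍ[ℝ]) =ᵐ[gaussianMeasure] hermiteSum n c ∘ slicePt I := by
  choose t ht hae using fun k => (hc k).exists_hasSum_hermiteLp hI k
  refine ⟨∑ k ∈ Finset.range (n + 1), t k, Submodule.sum_mem _ fun k hk => ?_, ?_⟩
  · refine mem_closure_of_tendsto (ht k) (Filter.Eventually.of_forall fun s => ?_)
    exact Submodule.sum_mem _ fun j _ =>
      hermiteLp_mem_hermiteSpan hI (Finset.mem_range_succ_iff.1 hk) _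
  · filter_upwards [Lp.coeFn_finsetSum (Finset.range (n + 1)) t, ae_all_iff.2 hae] with z h1 h2
    rw [h1, Finset.sum_apply]
    exact Finset.sum_congr rfl fun k _ => h2 k

lemma hermiteSum_mem_SR2 (hI : I ^ 2 = -1) (n : ℕ) {c : ℕ → ℕ → ℍ[ℝ]}
    (hc : ∀ k, BargmannCoeff (c k)) : hermiteSum n c ∈ SR2 I n := by
  obtain ⟨t, -, ht⟩ := exists_mem_closure_ae_eq_hermiteSum hI n hc
  exact ⟨hermiteSum_mem_SR n fun k => (hc k).entireCoeff, (memLp_congr_ae ht).1 (Lp.memLp t)⟩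

lemma hermiteQ_mem_SR2 (hI : I ^ 2 = -1) {n k : ℕ} (hk : k ≤ n) (j : ℕ) :
    hermiteQ j k ∈ SR2 I n := by
  have e : hermiteQ j k = hermiteSeries k (Pi.single j 1) := by
    funext q; rw [hermiteSeries_single, mul_one]
  refine ⟨e ▸ hermiteSeries_mem_SR hk (entireCoeff_single j 1), ?_⟩
  simpa only [mul_one, Function.comp_def] using memLp_hermiteQ_mul hI (j, k) 1

/-- An element of the closed span of the Hermite polynomials is the class of the sum of its
Hermite expansion, because the difference is orthogonal to the span. -/
lemma exists_mem_SR2_of_mem_closure (hI : I ^ 2 = -1) {n : ℕ} {g : Lp ℍ[ℝ] 2 gaussianMeasure}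
    (hg : g ∈ (hermiteSpan I n).topologicalClosure) :
    ∃ f ∈ SR2 I n, (g : ℂ → ℍ[ℝ]) =ᵐ[gaussianMeasure] f ∘ slicePt I := by
  choose c hc using exists_isHermiteCoeff hI g
  have hB := fun k => (hc k).bargmannCoeff
  obtain ⟨t, htcl, ht⟩ := exists_mem_closure_ae_eq_hermiteSum hI n hB
  refine ⟨hermiteSum n c, hermiteSum_mem_SR2 hI n hB, ?_⟩
  have hsub : hermiteSpan I n ≤ (ℝ ∙ (g - t))ᗮ := by
    refine Submodule.span_le.2 ?_
    rintro h ⟨j, k, a, hk, hh⟩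
    have e : h = hermiteLp hI (j, k) a := Lp.ext (hh.trans (coeFn_hermiteLp hI (j, k) a).symm)
    rw [SetLike.mem_coe, Submodule.mem_orthogonal_singleton_iff_inner_left, e, inner_sub_right,
      hc k j a, isHermiteCoeff_of_ae_eq_hermiteSum hI (fun k => (hB k).entireCoeff) ht hk j a,
      sub_self]
  have hcl := (hermiteSpan I n).topologicalClosure_minimal hsub
    (Submodule.isClosed_orthogonal _) (Submodule.sub_mem _ hg htcl)
  rw [Submodule.mem_orthogonal_singleton_iff_inner_left, inner_self_eq_zero, sub_eq_zero] at hcl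
  rwa [hcl]

lemma hermiteSum_zero (c : ℕ → ℕ → ℍ[ℝ]) : hermiteSum 0 c = hermiteSeries 0 (c 0) := by
  funext q; simp [hermiteSum]

/-- The slice Bargmann space consists of the power series with coefficients in the weighted
`ℓ²` space. -/
lemma mem_SR2_zero_iff (hI : I ^ 2 = -1) {F : ℍ[ℝ] → ℍ[ℝ]} :
    F ∈ SR2 I 0 ↔ ∃ c, BargmannCoeff c ∧ F = hermiteSeries 0 c := by
  constructor
  · intro hF
    obtain ⟨c, hc, rfl⟩ := exists_bargmannCoeff_of_mem_SR2 hI hF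
    exact ⟨c 0, hc 0, hermiteSum_zero c⟩
  · rintro ⟨c, hc, rfl⟩
    rw [← hermiteSum_zero fun _ => c]
    exact hermiteSum_mem_SR2 hI 0 fun _ => hc

/-- The Hermite series of index `k` are the functions `(∂_s - q̄) ^ k F`, with `F` in the slice
Bargmann space. -/
lemma exists_hermiteOp_iff (hI : I ^ 2 = -1) (k : ℕ) {f : ℍ[ℝ] → ℍ[ℝ]} :
    (∃ F ∈ SR2 I 0, f = hermiteOp k F) ↔ ∃ c, BargmannCoeff c ∧ f = hermiteSeries k c := by
  constructor
  · rintro ⟨F, hF, rfl⟩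
    obtain ⟨c, hc, rfl⟩ := (mem_SR2_zero_iff hI).1 hF
    exact ⟨_, hc.smul _, hermiteOp_hermiteSeries_zero k hc.entireCoeff⟩
  · rintro ⟨c, hc, rfl⟩
    refine ⟨_, (mem_SR2_zero_iff hI).2 ⟨_, hc.smul ((-1) ^ k), rfl⟩, ?_⟩
    rw [hermiteOp_hermiteSeries_zero k (hc.smul _).entireCoeff]
    simp only [smul_smul, ← mul_pow, neg_one_mul, neg_neg, one_pow, one_smul]

lemma mem_SR2_iff_exists_sum_hermiteOp (hI : I ^ 2 = -1) (n : ℕ) (f : ℍ[ℝ] → ℍ[ℝ]) :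
    f ∈ SR2 I n ↔ ∃ F : ℕ → ℍ[ℝ] → ℍ[ℝ], (∀ k ≤ n, F k ∈ SR2 I 0) ∧
      f = ∑ k ∈ Finset.range (n + 1), hermiteOp k (F k) := by
  constructor
  · intro hf
    obtain ⟨c, hc, rfl⟩ := exists_bargmannCoeff_of_mem_SR2 hI hf
    choose F hF hFc using fun k => (exists_hermiteOp_iff hI k).2 ⟨c k, hc k, rfl⟩
    refine ⟨F, fun k _ => hF k, ?_⟩
    funext q
    simp only [hermiteSum, Finset.sum_apply, ← hFc]
  · rintro ⟨F, hF, rfl⟩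
    have h : ∀ k, ∃ c, BargmannCoeff c ∧ (k ≤ n → hermiteOp k (F k) = hermiteSeries k c) := by
      intro k
      by_cases hk : k ≤ n
      · obtain ⟨c, hc, h⟩ := (exists_hermiteOp_iff hI k).1 ⟨F k, hF k hk, rfl⟩
        exact ⟨c, hc, fun _ => h⟩
      · exact ⟨_, bargmannCoeff_single 0 0, fun h => absurd h hk⟩
    choose c hc hFc using h
    convert hermiteSum_mem_SR2 hI n hc using 1
    funext q
    rw [hermiteSum, Finset.sum_apply]
    exact Finset.sum_congr rfl fun k hk => by rw [hFc k (Finset.mem_range_succ_iff.1 hk)]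

/-- A Hermite series of index `n` is a sum of Hermite series whose other components vanish. -/
lemma hermiteSeries_eq_hermiteSum (n : ℕ) (c : ℕ → ℍ[ℝ]) :
    hermiteSeries n c = hermiteSum n (Pi.single n c) := by
  funext q
  rw [hermiteSum, Finset.sum_eq_single n]
  · simp
  · intro k _ hk
    simp [Pi.single_eq_of_ne hk, hermiteSeries]
  · simp

/-- The eigenfunctions of `□_q` for the eigenvalue `n`: comparing coefficients, only the Hermite
series of index `n` survives. -/
lemma mem_SR2_inter_kerBoxSub_iff (hI : I ^ 2 = -1) (n : ℕ) (f : ℍ[ℝ] → ℍ[ℝ]) :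
    f ∈ SR2 I n ∩ kerBoxSub n ↔ ∃ c, BargmannCoeff c ∧ f = hermiteSeries n c := by
  constructor
  · rintro ⟨hf, hker⟩
    obtain ⟨c, hc, rfl⟩ := exists_bargmannCoeff_of_mem_SR2 hI hf
    refine ⟨c n, hc n, ?_⟩
    have h0 : hermiteSum n (fun k j => ((k : ℝ) - n) • c k j) = 0 := by
      funext q
      rw [Pi.zero_apply, ← hker q, sliceBox_hermiteSum n fun k => (hc k).entireCoeff]
      simp only [hermiteSum, hermiteSeries_smul]
      simp only [sub_smul, Finset.sum_sub_distrib, Finset.smul_sum]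
    have hzero : ∀ k < n, ∀ j, c k j = 0 := by
      intro k hk j
      have h := isHermiteCoeff_of_ae_eq_hermiteSum hI (n := n) (g := 0)
        (fun k => ((hc k).smul ((k : ℝ) - n)).entireCoeff)
        (by rw [h0]; exact Lp.coeFn_zero _ _ _) hk.le j (((k : ℝ) - n) • c k j)
      rw [inner_zero_right, eq_comm, mul_eq_zero, inner_self_eq_zero, smul_eq_zero] at h
      have hkn : ((k : ℝ) - n) ≠ 0 := sub_ne_zero.2 (by exact_mod_cast hk.ne)
      exact (h.resolve_left (hermiteWeight_pos _).ne').resolve_left hkn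
    funext q
    rw [hermiteSum, Finset.sum_range_succ, Finset.sum_eq_zero, zero_add]
    intro k hk
    simp [hermiteSeries, hzero k (Finset.mem_range.1 hk)]
  · rintro ⟨c, hc, rfl⟩
    have hs : ∀ k, BargmannCoeff ((Pi.single n c : ℕ → ℕ → ℍ[ℝ]) k) := by
      intro k
      rcases eq_or_ne k n with rfl | hk
      · simpa using hc
      · simp [Pi.single_eq_of_ne hk, BargmannCoeff]
    refine ⟨hermiteSeries_eq_hermiteSum n c ▸ hermiteSum_mem_SR2 hI n hs, fun q => ?_⟩
    rw [hermiteSeries_eq_hermiteSum, sliceBox_hermiteSum n fun k => (hs k).entireCoeff,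
      Finset.sum_eq_single n, hermiteSum, Finset.sum_eq_single n, sub_self]
    all_goals simp +contextual [Pi.single_eq_of_ne, hermiteSeries]

end Coefficients

end SPolyregular

open SPolyregular
theorem mainTheorem8 (n : ℕ) (I : ℍ[ℝ]) (hI : I ^ 2 = -1) :
    ((∀ j k : ℕ, k ≤ n → hermiteQ j k ∈ SR2 I n) ∧
      {g : Lp ℍ[ℝ] 2 gaussianMeasure |
          ∃ f ∈ SR2 I n, (g : ℂ → ℍ[ℝ]) =ᵐ[gaussianMeasure] f ∘ slicePt I} =
        closure (hermiteSpan I n : Set (Lp ℍ[ℝ] 2 gaussianMeasure)) ∧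
      SR2 I n = {f | ∃ F : ℕ → ℍ[ℝ] → ℍ[ℝ], (∀ k ≤ n, F k ∈ SR2 I 0) ∧
        f = ∑ k ∈ Finset.range (n + 1), hermiteOp k (F k)}) ∧
    (∀ f : ℍ[ℝ] → ℍ[ℝ],
      f ∈ SR2 I n ∩ kerBoxSub n ↔ ∃ F ∈ SR2 I 0, f = hermiteOp n F) := by
  refine ⟨⟨fun j k hk => hermiteQ_mem_SR2 hI hk j, ?_, Set.ext fun f =>
    mem_SR2_iff_exists_sum_hermiteOp hI n f⟩, fun f => ?_⟩
  · refine Set.Subset.antisymm ?_ fun g hg => exists_mem_SR2_of_mem_closure hI hg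
    rintro g ⟨f, hf, hgf⟩
    obtain ⟨c, hc, rfl⟩ := exists_bargmannCoeff_of_mem_SR2 hI hf
    obtain ⟨t, htcl, ht⟩ := exists_mem_closure_ae_eq_hermiteSum hI n hc
    rw [Lp.ext (hgf.trans ht.symm)]
    exact htcl
  · rw [mem_SR2_inter_kerBoxSub_iff hI, exists_hermiteOp_iff hI]
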